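/- Conventions. A quaternion Hermitian manifold $(\bar M,g,H)$ is a smooth manifold with a Riemannian metric $g$ and a rank $3$ subbundle $H\subset \mathrm{End}(T\bar M)$ that is locally spanned by smooth $g$-orthogonal almost complex structures $J_1,J_2,J_3$ with $J_1J_2=-J_2J_1=J_3$; such a triple of elements of a fibre of $H$ is called a quaternionic basis of it. It is locally conformal quaternion Kähler (l.c.q.K.) with Lee form $\omega$ if $\bar M$ is covered by open sets $U$ with smooth functions $f$ on $U$ such that $g|_U=e^{f}g'$, where the Levi-Civita connection $\nabla'$ of $g'$ satisfies $\nabla' H\subset H$ on $U$, and $\omega|_U=df$. The Lee vector field $B$ is defined by $\omega(X)=g(X,B)$. An (immersed) submanifold $M$ of $\bar M$ is a quaternion CR-submanifold if $TM=D\oplus D^\perp$ for two orthogonal complementary smooth distributions such that, for every $J\in H$, $JD\subseteq D$ and $JD^\perp\subseteq TM^\perp$ (the normal bundle of $M$); $D$ has constant rank $4p$. For $x\in M$ an adapted frame of $D_x$ is an orthonormal frame $e_1,\dots,e_{4p}$ of $D_x$ with $e_{ap+j}=J_ae_j$ $(1\le a\le 3,\ 1\le j\le p)$ for some quaternionic basis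 $J_1,J_2,J_3$ of $H_x$. Its dual coframe is the family of $w^1,\dots,w^{4p}\in T_x^*M$ with $w^i(e_j)=\delta_{ij}$ and $w^i(Z)=0$ for $Z\in D_x^\perp$. Theorem. Let $M$ be a closed (compact, without boundary) quaternion CR-submanifold of an l.c.q.K. manifold $\bar M$, and suppose that the Lee vector field $B$ is orthogonal to $D^\perp$ along $M$. Then there is exactly one $4p$-form $w$ on $M$ with $w_x=w^1\wedge\dots\wedge w^{4p}$ for every $x\in M$ and the dual coframe of every adapted frame of $D_x$; it is smooth and closed, $dw=0$, and so it defines a canonical de Rham cohomology class $[w]\in H^{4p}(M,\mathbb R)$, which depends on no choice of frames. -/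

import Mathlib

open Bundle Manifold Set Topology
open scoped ContDiff

noncomputable section

namespace QuaternionCR

/-! ### Vector fields, endomorphism fields, smooth distributions

All manifolds are modelled on a finite-dimensional real vector space `E` with the model with
corners `𝓘(ℝ, E)`; in particular they have no boundary. -/

section Basic

variable {E : Type*} [NormedAddCommGroup E] [NormedSpace ℝ E]
variable {M : Type*} [TopologicalSpace M] [ChartedSpace E M]

/-- The tangent space `T_x M`. -/
abbrev T (E : Type*) [NormedAddCommGroup E] [NormedSpace ℝ E]
    {M : Type*} [TopologicalSpace M] [ChartedSpace E M] (x : M) : Type _ :=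
  TangentSpace 𝓘(ℝ, E) x

/-- The space of endomorphisms of `T_x M`. -/
abbrev EndT (E : Type*) [NormedAddCommGroup E] [NormedSpace ℝ E]
    {M : Type*} [TopologicalSpace M] [ChartedSpace E M] (x : M) : Type _ :=
  T E x →L[ℝ] T E x

/-- A vector field is smooth on the set `U`. -/
def SmoothFieldOn [IsManifold 𝓘(ℝ, E) ∞ M] (X : ∀ x : M, T E x) (U : Set M) : Prop :=
  ContMDiffOn 𝓘(ℝ, E) (𝓘(ℝ, E).prod 𝓘(ℝ, E)) ∞
    (fun x ↦ TotalSpace.mk' E (E := fun y : M ↦ T E y) x (X x)) U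

/-- A vector field is differentiable at the point `x`. -/
def DiffFieldAt [IsManifold 𝓘(ℝ, E) ∞ M] (X : ∀ x : M, T E x) (x : M) : Prop :=
  MDifferentiableAt 𝓘(ℝ, E) (𝓘(ℝ, E).prod 𝓘(ℝ, E))
    (fun y ↦ TotalSpace.mk' E (E := fun z : M ↦ T E z) y (X y)) x

/-- A section of `End(TM)` is smooth on the set `U`. -/
def SmoothEndOn [IsManifold 𝓘(ℝ, E) ∞ M] (J : ∀ x : M, EndT E x) (U : Set M) : Prop :=
  ContMDiffOn 𝓘(ℝ, E) (𝓘(ℝ, E).prod 𝓘(ℝ, E →L[ℝ] E)) ∞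
    (fun x ↦ TotalSpace.mk' (E →L[ℝ] E) (E := fun y : M ↦ EndT E y) x (J x)) U

/-- `D` is a smooth distribution of rank `r` (a rank `r` subbundle of the tangent bundle):
locally it is spanned by `r` pointwise linearly independent smooth vector fields. -/
def IsDistribution [IsManifold 𝓘(ℝ, E) ∞ M] (D : ∀ x : M, Submodule ℝ (T E x)) (r : ℕ) : Prop :=
  ∀ x₀ : M, ∃ U : Set M, IsOpen U ∧ x₀ ∈ U ∧ ∃ X : Fin r → ∀ x : M, T E x,
    (∀ i, SmoothFieldOn (X i) U) ∧
    ∀ x ∈ U, LinearIndependent ℝ (fun i ↦ X i x) ∧ D x = Submodule.span ℝ (range fun i ↦ X i x)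

end Basic

/-! ### Differential forms and de Rham cohomology -/

section DeRham

variable {E : Type*} [NormedAddCommGroup E] [NormedSpace ℝ E]
variable {M : Type*} [TopologicalSpace M] [ChartedSpace E M]

/-- A (not necessarily smooth) field of alternating `k`-forms on the tangent spaces of `M`. -/
def FormField (E : Type*) [NormedAddCommGroup E] [NormedSpace ℝ E]
    (M : Type*) [TopologicalSpace M] [ChartedSpace E M] (k : ℕ) : Type _ :=
  ∀ x : M, T E x [⋀^Fin k]→L[ℝ] ℝ

instance (k : ℕ) : AddCommGroup (FormField E M k) :=
  inferInstanceAs (AddCommGroup (∀ x : M, T E x [⋀^Fin k]→L[ℝ] ℝ))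

instance (k : ℕ) : Module ℝ (FormField E M k) :=
  inferInstanceAs (Module ℝ (∀ x : M, T E x [⋀^Fin k]→L[ℝ] ℝ))

@[ext] theorem FormField.ext {k : ℕ} {α β : FormField E M k} (h : ∀ x, α x = β x) : α = β :=
  funext h

/-- The expression of a form in the preferred chart at `x₀`: its pullback to `E` by the inverse
of the chart (meaningful on the target of the chart). -/
def inChart {k : ℕ} (α : FormField E M k) (x₀ : M) (y : E) : E [⋀^Fin k]→L[ℝ] ℝ :=
  (α ((extChartAt 𝓘(ℝ, E) x₀).symm y)).compContinuousLinearMap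
    (mfderiv 𝓘(ℝ, E) 𝓘(ℝ, E) (extChartAt 𝓘(ℝ, E) x₀).symm y)

/-- The exterior derivative of a form on a manifold: at `x`, it is the pullback by the chart
at `x` of the exterior derivative of the expression of the form in this chart. -/
def extD {k : ℕ} (α : FormField E M k) : FormField E M (k + 1) := fun x ↦
  (extDeriv (inChart α x) (extChartAt 𝓘(ℝ, E) x x)).compContinuousLinearMap
    (mfderiv 𝓘(ℝ, E) 𝓘(ℝ, E) (extChartAt 𝓘(ℝ, E) x) x)

theorem inChart_add {k : ℕ} (α β : FormField E M k) (x₀ : M) :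
    inChart (α + β) x₀ = inChart α x₀ + inChart β x₀ := by
  ext y v; rfl

theorem inChart_smul {k : ℕ} (c : ℝ) (α : FormField E M k) (x₀ : M) :
    inChart (c • α) x₀ = c • inChart α x₀ := by
  ext y v; rfl

theorem inChart_zero {k : ℕ} (x₀ : M) :
    inChart (0 : FormField E M k) x₀ = 0 := by
  ext y v; rfl

/-- `Ω^k(M)`: the space of smooth `k`-forms, those whose expression in every (preferred) chart
is smooth. -/
def smoothForms (E : Type*) [NormedAddCommGroup E] [NormedSpace ℝ E]
    (M : Type*) [TopologicalSpace M] [ChartedSpace E M] (k : ℕ) :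
    Submodule ℝ (FormField E M k) where
  carrier := {α | ∀ x₀ : M, ContDiffOn ℝ ∞ (inChart α x₀) (extChartAt 𝓘(ℝ, E) x₀).target}
  add_mem' := by
    intro α β hα hβ x₀
    rw [inChart_add]
    exact (hα x₀).add (hβ x₀)
  zero_mem' := by
    intro x₀
    rw [inChart_zero]
    exact contDiffOn_const
  smul_mem' := by
    intro c α hα x₀
    rw [inChart_smul]
    exact contDiffOn_const.smul (hα x₀)

theorem differentiableAt_inChart {k : ℕ} (α : smoothForms E M k) (x : M) :
    DifferentiableAt ℝ (inChart α.1 x) (extChartAt 𝓘(ℝ, E) x x) :=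
  ((α.2 x).differentiableOn (by simp)).differentiableAt
    ((isOpen_extChartAt_target x).mem_nhds (mem_extChartAt_target x))

theorem extD_add {k : ℕ} (α β : smoothForms E M k) :
    extD (α + β).1 = extD α.1 + extD β.1 := by
  funext x
  simp only [extD, Submodule.coe_add, inChart_add]
  rw [extDeriv_add (differentiableAt_inChart α x) (differentiableAt_inChart β x)]
  rfl

theorem extD_smul {k : ℕ} (c : ℝ) (α : smoothForms E M k) :
    extD (c • α).1 = c • extD α.1 := by
  funext x
  simp only [extD, Submodule.coe_smul, inChart_smul]
  rw [extDeriv_smul]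
  rfl

/-- The exterior derivative on smooth forms, as a linear map. -/
def extDₗ (E : Type*) [NormedAddCommGroup E] [NormedSpace ℝ E]
    (M : Type*) [TopologicalSpace M] [ChartedSpace E M] (k : ℕ) :
    smoothForms E M k →ₗ[ℝ] FormField E M (k + 1) where
  toFun α := extD α.1
  map_add' := extD_add
  map_smul' := extD_smul

/-- The closed forms: smooth `k`-forms `α` with `dα = 0`. -/
def closedForms (E : Type*) [NormedAddCommGroup E] [NormedSpace ℝ E]
    (M : Type*) [TopologicalSpace M] [ChartedSpace E M] (k : ℕ) :
    Submodule ℝ (FormField E M k) :=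
  (LinearMap.ker (extDₗ E M k)).map (smoothForms E M k).subtype

theorem mem_closedForms {k : ℕ} {α : FormField E M k} :
    α ∈ closedForms E M k ↔ α ∈ smoothForms E M k ∧ extD α = 0 := by
  constructor
  · rintro ⟨β, hβ, rfl⟩
    exact ⟨β.2, hβ⟩
  · rintro ⟨h1, h2⟩
    exact ⟨⟨α, h1⟩, h2, rfl⟩

/-- The exact forms: in degree `0` only the zero form, in degree `k + 1` the smooth forms which
are `dβ` for some smooth `k`-form `β`. -/
def exactForms (E : Type*) [NormedAddCommGroup E] [NormedSpace ℝ E]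
    (M : Type*) [TopologicalSpace M] [ChartedSpace E M] :
    ∀ k : ℕ, Submodule ℝ (FormField E M k)
  | 0 => ⊥
  | k + 1 => LinearMap.range (extDₗ E M k) ⊓ smoothForms E M (k + 1)

/-- The de Rham cohomology `H^k(M, ℝ)`: closed `k`-forms modulo exact `k`-forms. -/
abbrev DeRham (E : Type*) [NormedAddCommGroup E] [NormedSpace ℝ E]
    (M : Type*) [TopologicalSpace M] [ChartedSpace E M] (k : ℕ) : Type _ :=
  closedForms E M k ⧸ (exactForms E M k).comap (closedForms E M k).subtype

/-- The de Rham class `[α]` of a closed form `α`. -/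
def deRhamClass {k : ℕ} (α : closedForms E M k) : DeRham E M k :=
  Submodule.Quotient.mk α

/-- The wedge product `θ¹ ∧ ⋯ ∧ θᵏ` of linear forms on a vector space: its value at
`(v₁, …, v_k)` is `det (θⁱ(v_j))`. -/
def wedge {V : Type*} [AddCommGroup V] [Module ℝ V] [TopologicalSpace V] {k : ℕ}
    (θ : Fin k → V →L[ℝ] ℝ) : V [⋀^Fin k]→L[ℝ] ℝ :=
  ContinuousAlternatingMap.compContinuousLinearMap
    { (Matrix.detRowAlternating : (Fin k → ℝ) [⋀^Fin k]→ₗ[ℝ] ℝ) with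
      cont := Continuous.matrix_det (A := fun v : Fin k → Fin k → ℝ ↦ Matrix.of v) continuous_id }
    (ContinuousLinearMap.pi θ)

theorem wedge_apply {V : Type*} [AddCommGroup V] [Module ℝ V] [TopologicalSpace V] {k : ℕ}
    (θ : Fin k → V →L[ℝ] ℝ) (v : Fin k → V) :
    wedge θ v = (Matrix.of fun i j ↦ θ i (v j)).det := by
  rw [← Matrix.det_transpose]
  rfl

end DeRham

/-! ### Quaternion Kähler and locally conformal quaternion Kähler manifolds -/

section Quaternion

variable {F : Type*} [NormedAddCommGroup F] [NormedSpace ℝ F]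
variable {N : Type*} [TopologicalSpace N] [ChartedSpace F N] [IsManifold 𝓘(ℝ, F) ∞ N]

/-- Three endomorphisms of a vector space satisfy the multiplication rules of the imaginary
quaternion units. -/
structure IsQuaternionTriple {V : Type*} [AddCommGroup V] [Module ℝ V] [TopologicalSpace V]
    (J : Fin 3 → V →L[ℝ] V) : Prop where
  sq (a : Fin 3) (v : V) : J a (J a v) = -v
  mul (v : V) : J 0 (J 1 v) = J 2 v
  anticomm (v : V) : J 1 (J 0 v) = -J 2 v

/-- `cov` is the Levi-Civita connection, over the open set `U`, of the metric `g` on `U`: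
it is a torsion-free covariant derivative for which `g` is parallel.
Here `cov Y x v` is `∇_v Y` at `x`. -/
structure IsLeviCivitaOn (g : ∀ x : N, T F x →L[ℝ] T F x →L[ℝ] ℝ) (U : Set N)
    (cov : (∀ x : N, T F x) → (∀ x : N, T F x →L[ℝ] T F x)) : Prop where
  isCov : IsCovariantDerivativeOn (I := 𝓘(ℝ, F)) F cov U
  torsionFree (X Y : ∀ x : N, T F x) (x : N) : x ∈ U → DiffFieldAt X x → DiffFieldAt Y x →
    cov Y x (X x) - cov X x (Y x) = VectorField.mlieBracket 𝓘(ℝ, F) X Y x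
  metric (X Y : ∀ x : N, T F x) (x : N) (v : T F x) : x ∈ U → DiffFieldAt X x → DiffFieldAt Y x →
    mvfderiv 𝓘(ℝ, F) (fun y ↦ g y (X y) (Y y)) x v =
      g x (cov X x v) (Y x) + g x (X x) (cov Y x v)

/-- The condition `∇H ⊂ H` over the open set `U`, for a subbundle `H` of `End(TN)`: for every
local smooth section `S` of `H` and every tangent vector `v`, the endomorphism
`∇_v S : Y ↦ ∇_v (S Y) - S (∇_v Y)` belongs to `H`. -/
def PreservesOn (H : ∀ x : N, Submodule ℝ (EndT F x)) (U : Set N)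
    (cov : (∀ x : N, T F x) → (∀ x : N, T F x →L[ℝ] T F x)) : Prop :=
  ∀ (V : Set N), IsOpen V → V ⊆ U → ∀ S : ∀ x : N, EndT F x, SmoothEndOn S V →
    (∀ x ∈ V, S x ∈ H x) →
    ∀ x ∈ V, ∀ v : T F x, ∃ K ∈ H x, ∀ Y : ∀ x : N, T F x, DiffFieldAt Y x →
      cov (fun y ↦ S y (Y y)) x v - S x (cov Y x v) = K (Y x)

/-- The metric `g` on the open set `U` is quaternion Kähler with respect to `H`: its Levi-Civita
connection preserves `H`. -/
def IsQuaternionKahlerOn (g : ∀ x : N, T F x →L[ℝ] T F x →L[ℝ] ℝ)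
    (H : ∀ x : N, Submodule ℝ (EndT F x)) (U : Set N) : Prop :=
  ∃ cov, IsLeviCivitaOn g U cov ∧ PreservesOn H U cov

/-- The structure of a quaternion Hermitian manifold `(N, g, H)`: a Riemannian metric `g` and a
rank 3 subbundle `H` of `End(TN)` locally spanned by smooth almost complex structures
`J₁, J₂, J₃ = J₁J₂ = -J₂J₁` which are orthogonal for `g`. -/
structure QuaternionHermitian (F : Type*) [NormedAddCommGroup F] [NormedSpace ℝ F]
    (N : Type*) [TopologicalSpace N] [ChartedSpace F N] [IsManifold 𝓘(ℝ, F) ∞ N] where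
  g : ContMDiffRiemannianMetric 𝓘(ℝ, F) ∞ F (fun x : N ↦ T F x)
  H : ∀ x : N, Submodule ℝ (EndT F x)
  finrank_H : ∀ x, Module.finrank ℝ (H x) = 3
  localBasis : ∀ x₀ : N, ∃ U : Set N, IsOpen U ∧ x₀ ∈ U ∧ ∃ J : Fin 3 → ∀ x : N, EndT F x,
    (∀ a, SmoothEndOn (J a) U) ∧
    ∀ x ∈ U, IsQuaternionTriple (fun a ↦ J a x) ∧
      H x = Submodule.span ℝ (range fun a ↦ J a x) ∧
      ∀ a v w, g.inner x (J a x v) (J a x w) = g.inner x v w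

/-- The structure of a locally conformal quaternion Kähler manifold: a quaternion Hermitian
manifold which can be covered by open sets `U` with `g = e^f g'` on `U`, where `g'` is a
quaternion Kähler metric on `U`. The Lee form `ω` is the 1-form which equals `df` on each `U`. -/
structure LCQK (F : Type*) [NormedAddCommGroup F] [NormedSpace ℝ F]
    (N : Type*) [TopologicalSpace N] [ChartedSpace F N] [IsManifold 𝓘(ℝ, F) ∞ N]
    extends QuaternionHermitian F N where
  leeForm : ∀ x : N, T F x →L[ℝ] ℝ
  locallyConformal : ∀ x₀ : N, ∃ U : Set N, IsOpen U ∧ x₀ ∈ U ∧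
    ∃ (f : N → ℝ) (g' : ∀ x : N, T F x →L[ℝ] T F x →L[ℝ] ℝ),
      ContMDiffOn 𝓘(ℝ, F) 𝓘(ℝ, ℝ) ∞ f U ∧
      (∀ x ∈ U, g.inner x = Real.exp (f x) • g' x) ∧
      (∀ x ∈ U, leeForm x = mvfderiv 𝓘(ℝ, F) f x) ∧
      IsQuaternionKahlerOn g' H U

theorem exists_sharp [FiniteDimensional ℝ F]
    (g : ContMDiffRiemannianMetric 𝓘(ℝ, F) ∞ F (fun x : N ↦ T F x)) (x : N)
    (α : T F x →L[ℝ] ℝ) : ∃ b : T F x, ∀ v, g.inner x v b = α v := by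
  have : FiniteDimensional ℝ (T F x) := inferInstanceAs (FiniteDimensional ℝ F)
  let φ : T F x →ₗ[ℝ] Module.Dual ℝ (T F x) :=
    { toFun := fun b ↦ (g.inner x b : T F x →ₗ[ℝ] ℝ)
      map_add' := fun a b ↦ by ext v; simp
      map_smul' := fun c b ↦ by ext v; simp }
  have hinj : Function.Injective φ := by
    rw [← LinearMap.ker_eq_bot, LinearMap.ker_eq_bot']
    intro b hb
    by_contra h
    have h1 : g.inner x b b = 0 := LinearMap.congr_fun hb b
    exact absurd h1 (g.pos x b h).ne'
  have hsurj : Function.Surjective φ :=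
    (LinearMap.injective_iff_surjective_of_finrank_eq_finrank
      Subspace.dual_finrank_eq.symm).1 hinj
  obtain ⟨b, hb⟩ := hsurj (α : T F x →ₗ[ℝ] ℝ)
  refine ⟨b, fun v ↦ ?_⟩
  rw [g.symm]
  exact LinearMap.congr_fun hb v

/-- The Lee vector field `B = ω^♯`. -/
def LCQK.leeField [FiniteDimensional ℝ F] (S : LCQK F N) (x : N) : T F x :=
  (exists_sharp S.g x (S.leeForm x)).choose

/-- The defining property of the Lee vector field: `ω(X) = g(X, B)`. -/
theorem LCQK.leeField_spec [FiniteDimensional ℝ F] (S : LCQK F N) (x : N) (v : T F x) :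
    S.g.inner x v (S.leeField x) = S.leeForm x v :=
  (exists_sharp S.g x (S.leeForm x)).choose_spec v

end Quaternion

/-! ### Quaternion CR-submanifolds and their canonical form -/

section Submanifold

variable {F : Type*} [NormedAddCommGroup F] [NormedSpace ℝ F]
variable {N : Type*} [TopologicalSpace N] [ChartedSpace F N] [IsManifold 𝓘(ℝ, F) ∞ N]
variable {E : Type*} [NormedAddCommGroup E] [NormedSpace ℝ E]
variable {M : Type*} [TopologicalSpace M] [ChartedSpace E M] [IsManifold 𝓘(ℝ, E) ∞ M]

/-- The differential `T_x M → T_{ι x} N`. -/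
abbrev push (F : Type*) [NormedAddCommGroup F] [NormedSpace ℝ F]
    {N : Type*} [TopologicalSpace N] [ChartedSpace F N]
    {E : Type*} [NormedAddCommGroup E] [NormedSpace ℝ E]
    {M : Type*} [TopologicalSpace M] [ChartedSpace E M] (ι : M → N) (x : M) :
    T E x →L[ℝ] T F (ι x) :=
  mfderiv 𝓘(ℝ, E) 𝓘(ℝ, F) ι x

/-- The orthogonal complement `D^⊥` of `D` in `TM`, for the metric induced by `ι : M → N`. -/
def perp (S : QuaternionHermitian F N) (ι : M → N) (D : ∀ x : M, Submodule ℝ (T E x)) (x : M) :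
    Submodule ℝ (T E x) where
  carrier := {Z | ∀ X ∈ D x, S.g.inner (ι x) (push F ι x X) (push F ι x Z) = 0}
  add_mem' := by
    intro a b ha hb X hX
    rw [map_add, map_add, ha X hX, hb X hX, add_zero]
  zero_mem' := by
    intro X _
    rw [map_zero, map_zero]
  smul_mem' := by
    intro c a ha X hX
    rw [map_smul, map_smul, ha X hX, smul_zero]

/-- `M`, immersed in `N` by `ι`, is a quaternion CR-submanifold with quaternion distribution `D`
of quaternionic dimension `p` (real rank `4p`) and anti-invariant distribution `D^⊥`: `D` is
invariant under the `J ∈ H`, and the `J ∈ H` map `D^⊥` into the normal bundle of `M`. -/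
structure IsQuaternionCRSubmanifold (S : QuaternionHermitian F N) (ι : M → N)
    (D : ∀ x : M, Submodule ℝ (T E x)) (p : ℕ) : Prop where
  smooth : ContMDiff 𝓘(ℝ, E) 𝓘(ℝ, F) ∞ ι
  immersion : ∀ x, Function.Injective (push F ι x : T E x → T F (ι x))
  distribution : IsDistribution D (4 * p)
  invariant : ∀ x, ∀ J ∈ S.H (ι x), ∀ X ∈ D x, ∃ X' ∈ D x, push F ι x X' = J (push F ι x X)
  totallyReal : ∀ x, ∀ J ∈ S.H (ι x), ∀ Z ∈ perp S ι D x, ∀ Y : T E x,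
    S.g.inner (ι x) (J (push F ι x Z)) (push F ι x Y) = 0

/-- `(e_i)`, `i = 1, …, 4p`, is an adapted orthonormal frame of `D` at `x`: it has the form
`e₁, …, e_p, J₁e₁, …, J₁e_p, J₂e₁, …, J₂e_p, J₃e₁, …, J₃e_p` for a quaternionic basis
`J₁, J₂, J₃` of `H` at `ι x`.
The index `(a, j) : Fin 4 × Fin p` corresponds to the index `a p + j : Fin (4p)`. -/
structure IsAdaptedFrame (S : QuaternionHermitian F N) (ι : M → N)
    (D : ∀ x : M, Submodule ℝ (T E x)) (p : ℕ) (x : M)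
    (J : Fin 3 → EndT F (ι x)) (e : Fin (4 * p) → T E x) : Prop where
  mem_H : ∀ a, J a ∈ S.H (ι x)
  triple : IsQuaternionTriple J
  mem_D : ∀ i, e i ∈ D x
  orthonormal : ∀ i j,
    S.g.inner (ι x) (push F ι x (e i)) (push F ι x (e j)) = if i = j then 1 else 0
  quaternionic : ∀ (a : Fin 3) (j : Fin p),
    push F ι x (e (finProdFinEquiv (a.succ, j))) = J a (push F ι x (e (finProdFinEquiv (0, j))))

/-- The linear forms `θⁱ` on `T_x M` are dual to the frame `(e_i)` of `D` and vanish on `D^⊥`. -/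
structure IsDualCoframe (S : QuaternionHermitian F N) (ι : M → N)
    (D : ∀ x : M, Submodule ℝ (T E x)) {k : ℕ} (x : M)
    (e : Fin k → T E x) (θ : Fin k → T E x →L[ℝ] ℝ) : Prop where
  vanish : ∀ i, ∀ Z ∈ perp S ι D x, θ i Z = 0
  dual : ∀ i j, θ i (e j) = if i = j then 1 else 0

/-- `w` is the form `w¹ ∧ ⋯ ∧ w^{4p}` built from the dual coframe of `D`, for every choice of
the adapted frame. -/
def IsCanonicalForm (S : QuaternionHermitian F N) (ι : M → N)
    (D : ∀ x : M, Submodule ℝ (T E x)) (p : ℕ) (w : FormField E M (4 * p)) : Prop :=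
  ∀ (x : M) (J : Fin 3 → EndT F (ι x)) (e : Fin (4 * p) → T E x)
    (θ : Fin (4 * p) → T E x →L[ℝ] ℝ),
    IsAdaptedFrame S ι D p x J e → IsDualCoframe S ι D x e θ → w x = wedge θ

end Submanifold

end QuaternionCR

end

open QuaternionCR

/-! Near a point choose a local section J₀ of H and put Ω(u,v) = g(J₀u,v). With g = e^f g' and K_t =
∇'_t J₀, which lies in H, the product rule gives dΩ = ω∧Ω plus the cyclic sum of g(K_t u, v): the
connection terms cancel because ∇' is torsion-free. Since J₀ is g'-orthogonal, g(K_t w, J₀w) = 0.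
This is `LCQK.exists_first_order` and `LCQK.exists_twoFormDeriv`.

Pull back to M. A vector z of D^⊥ is killed by ω (B is orthogonal to D^⊥) and by every form g(L·,·),
L ∈ H (total reality). Hence, for z, z' in D^⊥ and d in D, dΩ(z,z',·) = 0 and dΩ(z,d,J₀d) = 0.
Moreover Ω = ∑ εᵢ θⁱ⊗θ^{σi} in the coframe of an adapted frame, where J₀eᵢ = εᵢ e_{σi}. Comparing
coefficients gives dθⁱ(z,z') = 0 and dθⁱ(z,eᵢ) + dθ^{σi}(z,e_{σi}) = 0, so ∑ dθⁱ(z,eᵢ) = 0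
(`extDeriv_wedge_eq_zero_of_twoForm`). A single J₀ suffices.

These two facts say that dw, with w = θ¹∧⋯∧θ^{4p}, vanishes on (z,z',…) and on (z,e₁,…,e_{4p}).
Since D has rank 4p, a form of degree 4p+1 is determined by such values
(`alternating_eq_zero_of_contractions`), so dw = 0. Smooth adapted frames, hence smoothness of w,
come from a quaternionic Gram-Schmidt process (`exists_adapted_frame`); everything local is gathered
in `exists_local_frame`.

Independence of the frame is a matter of orientation. Two adapted frames differ by an orthogonal
matrix. Its determinant is a power of that of the change of quaternionic basis, times that of a
J₀-complex-linear map; both are nonnegative (`QuaternionRules.basis_det_nonneg`), so it is 1. -/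

noncomputable section

namespace QuaternionCR

/-! ### Alternating forms determined by their contractions. -/

section Alternating

variable {V : Type*} [AddCommGroup V] [Module ℝ V]

/-- An alternating map which vanishes as soon as its first argument lies in `K` vanishes as soon
as some argument lies in `K`. -/
theorem alternating_eq_zero_of_mem {k : ℕ} (ζ : V [⋀^Fin (k + 1)]→ₗ[ℝ] ℝ) (K : Set V)
    (h : ∀ z ∈ K, ∀ v : Fin k → V, ζ (Matrix.vecCons z v) = 0)
    (v : Fin (k + 1) → V) (i : Fin (k + 1)) (hi : v i ∈ K) : ζ v = 0 := by
  by_cases h0 : i = 0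
  · subst h0
    have := h _ hi (Matrix.vecTail v)
    rwa [show Matrix.vecCons (v 0) (Matrix.vecTail v) = v from Matrix.cons_head_tail v] at this
  · have h1 := ζ.map_swap v (Ne.symm h0)
    have h2 := h _ hi (Matrix.vecTail (v ∘ Equiv.swap 0 i))
    have h3 : Matrix.vecCons (v i) (Matrix.vecTail (v ∘ Equiv.swap 0 i)) = v ∘ Equiv.swap 0 i := by
      have := Matrix.cons_head_tail (v ∘ Equiv.swap 0 i)
      rwa [show Matrix.vecHead (v ∘ Equiv.swap 0 i) = v i by simp [Matrix.vecHead]] at this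
    rw [h3, h1] at h2
    linarith

variable {n : ℕ} {e : Fin n → V} {θ : Fin n → V →ₗ[ℝ] ℝ}

/-- An alternating map which vanishes when an argument is killed by all `θ i`, and on the
injective tuples of vectors of the dual family `e`, is zero. -/
theorem alternating_eq_zero_of_dual {k : ℕ} (hd : ∀ i j, θ i (e j) = if i = j then 1 else 0)
    (ζ : V [⋀^Fin k]→ₗ[ℝ] ℝ)
    (h1 : ∀ (v : Fin k → V) (i : Fin k), (∀ l, θ l (v i) = 0) → ζ v = 0)
    (h2 : ∀ s : Fin k → Fin n, Function.Injective s → ζ (fun i ↦ e (s i)) = 0) : ζ = 0 := by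
  ext v
  let P : V → V := fun u ↦ ∑ i, θ i u • e i
  have hP (u : V) (l : Fin n) : θ l (u - P u) = 0 := by
    simp [P, hd]
  have hv : v = (fun i ↦ P (v i)) + (fun i ↦ v i - P (v i)) := by ext; simp
  have key : ζ v = ζ (fun i ↦ P (v i)) := by
    conv_lhs => rw [hv]
    have := ζ.toMultilinearMap.map_add_univ (fun i ↦ P (v i)) (fun i ↦ v i - P (v i))
    simp only [AlternatingMap.coe_multilinearMap] at this
    -- In the expansion over subsets, every term but the full one contains an argument u - P u,
    -- which all `θ l` kill.
    rw [this, Finset.sum_eq_single Finset.univ]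
    · simp
    · intro s _ hs
      obtain ⟨i, hi⟩ : ∃ i, i ∉ s := by
        by_contra! hh
        exact hs (Finset.eq_univ_of_forall hh)
      refine h1 _ i fun l ↦ ?_
      rw [Finset.piecewise_eq_of_notMem _ _ _ hi]
      exact hP _ _
    · simp
  rw [key]
  have := ζ.toMultilinearMap.map_sum (fun (i : Fin k) (j : Fin n) ↦ θ j (v i) • e j)
  simp only [AlternatingMap.coe_multilinearMap] at this
  rw [show (fun i ↦ P (v i)) = fun i ↦ ∑ j, θ j (v i) • e j from rfl, this]
  refine Finset.sum_eq_zero fun s _ ↦ ?_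
  have h3 := ζ.toMultilinearMap.map_smul_univ (fun i ↦ θ (s i) (v i)) (fun i ↦ e (s i))
  simp only [AlternatingMap.coe_multilinearMap] at h3
  rw [h3]
  by_cases hs : Function.Injective s
  · rw [h2 s hs, smul_zero]
  · have : ¬ Function.Injective (fun i ↦ e (s i)) := fun h ↦ hs fun a b hab ↦ h (by simp [hab])
    rw [Function.not_injective_iff] at this
    obtain ⟨a, b, hab, hne⟩ := this
    rw [ζ.map_eq_zero_of_eq _ hab hne, smul_zero]

/-- A form of degree `n + 1` on a space with a subspace spanned by `e₁, …, eₙ` is zero if it is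
killed by the contraction with two vectors of the complement and by the contraction with
one such vector and `e₁, …, eₙ`. -/
theorem alternating_eq_zero_of_contractions {m : ℕ} {e : Fin (m + 1) → V}
    {θ : Fin (m + 1) → V →ₗ[ℝ] ℝ}
    (hd : ∀ i j, θ i (e j) = if i = j then 1 else 0) (η : V [⋀^Fin (m + 2)]→ₗ[ℝ] ℝ)
    (h1 : ∀ z z', (∀ l, θ l z = 0) → (∀ l, θ l z' = 0) → ∀ v : Fin m → V,
      η (Matrix.vecCons z (Matrix.vecCons z' v)) = 0)
    (h2 : ∀ z, (∀ l, θ l z = 0) → η (Matrix.vecCons z e) = 0) : η = 0 := by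
  refine alternating_eq_zero_of_dual hd η (fun v i hi ↦ ?_) fun s hs ↦ ?_
  · refine alternating_eq_zero_of_mem η {z | ∀ l, θ l z = 0} (fun z hz u ↦ ?_) v i hi
    have : η.curryLeft z = 0 := by
      refine alternating_eq_zero_of_dual hd _ (fun v i hi ↦ ?_) fun s hs ↦ ?_
      · exact alternating_eq_zero_of_mem (η.curryLeft z) {z | ∀ l, θ l z = 0}
          (fun z' hz' v ↦ h1 z z' hz hz' v) v i hi
      -- After contraction with z there remain as many arguments as vectors in `e`, so an injective
      -- choice is a permutation and only a sign separates it from `e`.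
      · let σ : Equiv.Perm (Fin (m + 1)) := Equiv.ofBijective s (Finite.injective_iff_bijective.1 hs)
        have h3 := (η.curryLeft z).map_perm e σ
        have h4 : η.curryLeft z e = 0 := h2 z hz
        rw [h4, smul_zero] at h3
        exact h3
    exact DFunLike.congr_fun this u
  -- Without a vector of the complement, m + 2 distinct vectors would be needed among m + 1.
  · have := Fintype.card_le_of_injective s hs
    simp at this

end Alternating

/-! ### Orientation of quaternionic frames. -/

section Orientation

/-- An endomorphism of a real vector space commuting with a complex structure has nonnegative
determinant. -/
theorem det_nonneg_of_commute {V : Type*} [AddCommGroup V] [Module ℝ V]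
    (J f : V →ₗ[ℝ] V) (hJ : ∀ v, J (J v) = -v) (hf : ∀ v, f (J v) = J (f v)) :
    0 ≤ LinearMap.det f := by
  -- J makes V a complex vector space on which f is ℂ-linear; its real determinant is then the
  -- squared modulus of the complex one.
  let ρ : ℂ →ₐ[ℝ] Module.End ℝ V := Complex.lift ⟨J, by ext v; simp [hJ]⟩
  let _ : Module ℂ V := Module.compHom V ρ.toRingHom
  have hsm (c : ℂ) (v : V) : c • v = c.re • v + c.im • J v := by
    change ρ c v = _
    simp [ρ, Complex.lift_apply]
  have : IsScalarTower ℝ ℂ V := ⟨fun r c v ↦ by simp [hsm, mul_smul]⟩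
  let fc : V →ₗ[ℂ] V :=
    { f with
      map_smul' := fun c v ↦ by
        simp [hsm, hf] }
  have : f = fc.restrictScalars ℝ := rfl
  rw [this, LinearMap.det_restrictScalars, Algebra.norm_complex_apply]
  exact Complex.normSq_nonneg _

/-- The multiplication rules of the imaginary quaternion units for linear maps. -/
structure QuaternionRules {V : Type*} [AddCommGroup V] [Module ℝ V] (J : Fin 3 → V →ₗ[ℝ] V) :
    Prop where
  sq (a : Fin 3) (v : V) : J a (J a v) = -v
  mul (v : V) : J 0 (J 1 v) = J 2 v
  anticomm (v : V) : J 1 (J 0 v) = -J 2 v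

namespace QuaternionRules

variable {V : Type*} [AddCommGroup V] [Module ℝ V] {J : Fin 3 → V →ₗ[ℝ] V}

theorem mul02 (h : QuaternionRules J) (v : V) : J 0 (J 2 v) = -J 1 v := by
  rw [← h.mul, h.sq]

theorem mul21 (h : QuaternionRules J) (v : V) : J 2 (J 1 v) = -J 0 v := by
  rw [← h.mul, h.sq, map_neg]

theorem mul12 (h : QuaternionRules J) (v : V) : J 1 (J 2 v) = J 0 v := by
  have := h.anticomm v
  rw [← neg_eq_iff_eq_neg] at this
  rw [← this, map_neg, h.sq, neg_neg]

theorem mul20 (h : QuaternionRules J) (v : V) : J 2 (J 0 v) = J 1 v := by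
  have := h.anticomm (J 0 v)
  rw [h.sq, map_neg] at this
  exact (neg_inj.1 this).symm

/-- The identity and the imaginary units are linearly independent at each nonzero vector. -/
theorem eq_zero_of_combination (h : QuaternionRules J) {v : V} (hv : v ≠ 0) {r x y z : ℝ}
    (h0 : r • v + x • J 0 v + y • J 1 v + z • J 2 v = 0) : r = 0 ∧ x = 0 ∧ y = 0 ∧ z = 0 := by
  -- Multiplication by the conjugate quaternion r - xJ₀ - yJ₁ - zJ₂ turns the combination into its
  -- squared norm times v.
  have e0 : r • (r • v + x • J 0 v + y • J 1 v + z • J 2 v)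
      - x • J 0 (r • v + x • J 0 v + y • J 1 v + z • J 2 v)
      - y • J 1 (r • v + x • J 0 v + y • J 1 v + z • J 2 v)
      - z • J 2 (r • v + x • J 0 v + y • J 1 v + z • J 2 v) = 0 := by simp [h0]
  have e1 : (r ^ 2 + x ^ 2 + y ^ 2 + z ^ 2) • v = 0 := by
    rw [← e0]
    simp only [map_add, map_smul, h.sq, h.mul, h.anticomm, h.mul02, h.mul21, h.mul12, h.mul20]
    module
  have e2 := (smul_eq_zero.1 e1).resolve_right hv
  refine ⟨?_, ?_, ?_, ?_⟩ <;> nlinarith [sq_nonneg r, sq_nonneg x, sq_nonneg y, sq_nonneg z]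

/-- The change of quaternionic bases has nonnegative determinant. -/
theorem det_nonneg [Nontrivial V] (h : QuaternionRules J) {J' : Fin 3 → V →ₗ[ℝ] V}
    (h' : QuaternionRules J') {A : Matrix (Fin 3) (Fin 3) ℝ}
    (hA : ∀ a v, J' a v = ∑ b, A a b • J b v) : 0 ≤ A.det := by
  obtain ⟨v, hv⟩ := exists_ne (0 : V)
  have e0 := h'.mul v
  simp only [hA, Fin.sum_univ_three, map_add, map_smul, h.sq, h.mul, h.anticomm, h.mul02, h.mul21,
    h.mul12, h.mul20] at e0
  -- Comparing coefficients in J'₀J'₁v = J'₂v shows that the third row of A is the cross product of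
  -- the first two, so det A is the squared length of that row.
  obtain ⟨-, h1, h2, h3⟩ := h.eq_zero_of_combination hv
    (r := -(A 0 0 * A 1 0 + A 0 1 * A 1 1 + A 0 2 * A 1 2))
    (x := A 0 1 * A 1 2 - A 0 2 * A 1 1 - A 2 0) (y := A 0 2 * A 1 0 - A 0 0 * A 1 2 - A 2 1)
    (z := A 0 0 * A 1 1 - A 0 1 * A 1 0 - A 2 2) (by
      rw [← sub_eq_zero] at e0
      rw [← e0]
      module)
  have : A.det = A 2 0 ^ 2 + A 2 1 ^ 2 + A 2 2 ^ 2 := by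
    rw [Matrix.det_fin_three]
    linear_combination A 2 0 * h1 + A 2 1 * h2 + A 2 2 * h3
  rw [this]
  positivity

/-- Two bases adapted to quaternionic structures with the same span have the same orientation. -/
theorem basis_det_nonneg [Nontrivial V] (h : QuaternionRules J) {J' : Fin 3 → V →ₗ[ℝ] V}
    (h' : QuaternionRules J') {A : Matrix (Fin 3) (Fin 3) ℝ}
    (hA : ∀ a v, J' a v = ∑ b, A a b • J b v) {p : ℕ}
    (b : Module.Basis (Fin 4 × Fin p) ℝ V) (b' : Fin 4 × Fin p → V)
    (hb : ∀ a j, b (a.succ, j) = J a (b (0, j)))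
    (hb' : ∀ a j, b' (a.succ, j) = J' a (b' (0, j))) : 0 ≤ b.det b' := by
  -- An intermediate frame c is used: it has the generators of b' but the units J of b. From c to b'
  -- the change is B = diag(1, A) in each quaternionic line; from b to c it is a map f commuting
  -- with J₀.
  let Q : Fin 4 → V →ₗ[ℝ] V := Fin.cons LinearMap.id J
  let c : Fin 4 × Fin p → V := fun i ↦ Q i.1 (b' (0, i.2))
  let B : Matrix (Fin 4) (Fin 4) ℝ :=
    Matrix.of (Fin.cons (Fin.cons 1 0) fun a ↦ Fin.cons 0 (A a))
  have hB : 0 ≤ B.det := by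
    have : B.det = A.det := by
      rw [Matrix.det_succ_row_zero]
      simp [Fin.sum_univ_succ, B]
      congr 1
    rw [this]
    exact h.det_nonneg h' hA
  have hc (a : Fin 4) (j : Fin p) : b' (a, j) = ∑ k, B a k • c (k, j) := by
    refine Fin.cases ?_ (fun a ↦ ?_) a
    · simp [B, Fin.sum_univ_succ, c, Q]
    · rw [hb', hA]
      simp [B, c, Q, Fin.sum_univ_succ]
  -- The Kronecker factor has determinant (det B)^p, which is nonnegative because det B = det A is.
  have hmat : b.toMatrix b' = b.toMatrix c *
      (Matrix.kroneckerMap (· * ·) B.transpose (1 : Matrix (Fin p) (Fin p) ℝ)) := by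
    ext i ⟨a, j⟩
    rw [Matrix.mul_apply, Module.Basis.toMatrix_apply, hc, map_sum, Fintype.sum_prod_type]
    simp [Matrix.one_apply, Module.Basis.toMatrix_apply, mul_comm]
  let f : V →ₗ[ℝ] V := b.constr ℝ c
  have hf (i) : f (b i) = c i := b.constr_basis ℝ c i
  have hf' (a : Fin 4) (j : Fin p) : f (J 0 (b (a, j))) = J 0 (c (a, j)) := by
    have h0 : c (0, j) = b' (0, j) := rfl
    have hs (a : Fin 3) : c (a.succ, j) = J a (c (0, j)) := rfl
    refine Fin.cases ?_ (fun a ↦ ?_) a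
    · rw [← hb, hf, hs]
    · rw [hb, hs]
      fin_cases a
      · simp [h.sq, hf]
      · simp only [Fin.mk_one, h.mul]
        rw [← hb, hf, hs]
      · simp only [Fin.reduceFinMk, h.mul02, map_neg]
        rw [← hb, hf, hs]
  have hcomm : f ∘ₗ J 0 = J 0 ∘ₗ f := by
    refine b.ext fun ⟨a, j⟩ ↦ ?_
    simp [hf', hf]
  have hdet : b.det c = LinearMap.det f := by
    have := b.det_comp f b
    rw [b.det_self, mul_one] at this
    rw [← this]
    congr 1
    ext i
    exact (hf i).symm
  rw [Module.Basis.det_apply, hmat, Matrix.det_mul, Matrix.det_kronecker, ← Module.Basis.det_apply,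
    hdet, Matrix.det_transpose]
  have := det_nonneg_of_commute (J 0) f (h.sq 0) fun v ↦ LinearMap.congr_fun hcomm v
  simp only [Matrix.det_one, one_pow, mul_one]
  positivity

end QuaternionRules

end Orientation

/-! ### Smooth adapted frames by quaternionic Gram-Schmidt. -/

section Frame

variable {E : Type*} [NormedAddCommGroup E] [NormedSpace ℝ E]

/-- The identity followed by the three given endomorphisms. -/
def unitsWithOne (A : Fin 3 → E →L[ℝ] E) : Fin 4 → E →L[ℝ] E :=
  Fin.cons (ContinuousLinearMap.id ℝ E) A

@[simp] theorem unitsWithOne_zero (A : Fin 3 → E →L[ℝ] E) (u : E) : unitsWithOne A 0 u = u := rfl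

@[simp] theorem unitsWithOne_succ (A : Fin 3 → E →L[ℝ] E) (a : Fin 3) :
    unitsWithOne A a.succ = A a := rfl

/-- On the subspace `D` the endomorphisms `A` are quaternionic units orthogonal for the inner
product `h`. -/
structure QuaternionHermitianOn (h : E →L[ℝ] E →L[ℝ] ℝ) (A : Fin 3 → E →L[ℝ] E)
    (D : Submodule ℝ E) : Prop where
  symm (u v : E) : h u v = h v u
  pos (u : E) : u ≠ 0 → 0 < h u u
  mem (a : Fin 3) (u : E) : u ∈ D → A a u ∈ D
  sq (a : Fin 3) (u : E) : u ∈ D → A a (A a u) = -u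
  mul (u : E) : u ∈ D → A 0 (A 1 u) = A 2 u
  anticomm (u : E) : u ∈ D → A 1 (A 0 u) = -A 2 u
  orth (a : Fin 3) (u v : E) : u ∈ D → v ∈ D → h (A a u) (A a v) = h u v

namespace QuaternionHermitianOn

variable {h : E →L[ℝ] E →L[ℝ] ℝ} {A : Fin 3 → E →L[ℝ] E} {D : Submodule ℝ E}

theorem units_mem (H : QuaternionHermitianOn h A D) (a : Fin 4) {u : E} (hu : u ∈ D) :
    unitsWithOne A a u ∈ D := by
  refine Fin.cases ?_ (fun a ↦ ?_) a
  · exact hu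
  · exact H.mem a u hu

theorem skew (H : QuaternionHermitianOn h A D) (a : Fin 3) {u v : E} (hu : u ∈ D) (hv : v ∈ D) :
    h (A a u) v = -h u (A a v) := by
  rw [← H.orth a u (A a v) hu (H.mem a v hv), H.sq a v hv, map_neg, neg_neg]

theorem skew_self (H : QuaternionHermitianOn h A D) (a : Fin 3) {u : E} (hu : u ∈ D) :
    h u (A a u) = 0 := by
  have := H.skew a hu hu
  rw [H.symm] at this
  linarith

/-- This is the quaternion multiplication table up to sign. The clause `c ≠ 0` records that the
product of two distinct units has no real part, which makes the units of one vector mutually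
orthogonal. -/
theorem units_units (H : QuaternionHermitianOn h A D) (a b : Fin 4) :
    ∃ (c : Fin 4) (ε : ℝ), (a ≠ b → c ≠ 0) ∧
      ∀ u ∈ D, unitsWithOne A a (unitsWithOne A b u) = ε • unitsWithOne A c u := by
  have m02 : ∀ u ∈ D, A 0 (A 2 u) = -A 1 u := fun u hu ↦ by
    rw [← H.mul u hu, H.sq _ _ (H.mem _ _ hu)]
  have m21 : ∀ u ∈ D, A 2 (A 1 u) = -A 0 u := fun u hu ↦ by
    rw [← H.mul _ (H.mem _ _ hu), H.sq _ _ hu, map_neg]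
  have m12 : ∀ u ∈ D, A 1 (A 2 u) = A 0 u := fun u hu ↦ by
    have := H.anticomm u hu
    rw [← neg_eq_iff_eq_neg] at this
    rw [← this, map_neg, H.sq _ _ (H.mem _ _ hu), neg_neg]
  have m20 : ∀ u ∈ D, A 2 (A 0 u) = A 1 u := fun u hu ↦ by
    have := H.anticomm _ (H.mem 0 _ hu)
    rw [H.sq _ _ hu, map_neg] at this
    exact (neg_inj.1 this).symm
  refine Fin.cases ?_ (fun a ↦ ?_) a
  · exact ⟨b, 1, fun h0 ↦ h0.symm, fun u _ ↦ by simp⟩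
  · refine Fin.cases ?_ (fun b ↦ ?_) b
    · exact ⟨a.succ, 1, fun h0 ↦ h0, fun u _ ↦ by simp⟩
    · by_cases hab : a = b
      · subst hab
        exact ⟨0, -1, fun h0 ↦ absurd rfl h0, fun u hu ↦ by simp [H.sq a u hu]⟩
      · simp only [unitsWithOne_succ]
        fin_cases a <;> fin_cases b <;> try exact absurd rfl hab
        · exact ⟨Fin.succ 2, 1, fun _ ↦ Fin.succ_ne_zero _, fun u hu ↦ by
            rw [unitsWithOne_succ, one_smul]; exact H.mul u hu⟩
        · exact ⟨Fin.succ 1, -1, fun _ ↦ Fin.succ_ne_zero _, fun u hu ↦ by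
            rw [unitsWithOne_succ, neg_one_smul]; exact m02 u hu⟩
        · exact ⟨Fin.succ 2, -1, fun _ ↦ Fin.succ_ne_zero _, fun u hu ↦ by
            rw [unitsWithOne_succ, neg_one_smul]; exact H.anticomm u hu⟩
        · exact ⟨Fin.succ 0, 1, fun _ ↦ Fin.succ_ne_zero _, fun u hu ↦ by
            rw [unitsWithOne_succ, one_smul]; exact m12 u hu⟩
        · exact ⟨Fin.succ 1, 1, fun _ ↦ Fin.succ_ne_zero _, fun u hu ↦ by
            rw [unitsWithOne_succ, one_smul]; exact m20 u hu⟩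
        · exact ⟨Fin.succ 0, -1, fun _ ↦ Fin.succ_ne_zero _, fun u hu ↦ by
            rw [unitsWithOne_succ, neg_one_smul]; exact m21 u hu⟩

/-- Skewness moves the unit on u across to v, where it combines with the other unit into a single
one. Gram-Schmidt therefore needs orthogonality only of the new generator, not of its multiples. -/
theorem inner_units_units (H : QuaternionHermitianOn h A D) {u v : E} (hu : u ∈ D) (hv : v ∈ D)
    (h0 : ∀ c, h u (unitsWithOne A c v) = 0) (a b : Fin 4) :
    h (unitsWithOne A a u) (unitsWithOne A b v) = 0 := by
  obtain ⟨c, ε, -, hc⟩ := H.units_units a b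
  revert hc
  refine Fin.cases (fun _ ↦ h0 b) (fun a hc ↦ ?_) a
  rw [unitsWithOne_succ, H.skew a hu (H.units_mem b hv), ← unitsWithOne_succ A a, hc v hv, map_smul,
    h0, smul_zero, neg_zero]

theorem inner_units_self (H : QuaternionHermitianOn h A D) {u : E} (hu : u ∈ D) (a b : Fin 4) :
    h (unitsWithOne A a u) (unitsWithOne A b u) = if a = b then h u u else 0 := by
  split_ifs with hab
  · subst hab
    refine Fin.cases rfl (fun a ↦ H.orth a u u hu hu) a
  · obtain ⟨c, ε, h1, hc⟩ := H.units_units a b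
    have hc0 := h1 hab
    have key : ∀ c ≠ 0, h u (unitsWithOne A c u) = 0 := by
      intro c
      refine Fin.cases (fun h ↦ absurd rfl h) (fun c _ ↦ H.skew_self c hu) c
    revert hc hab
    refine Fin.cases (fun hab _ ↦ key b (Ne.symm hab)) (fun a _ hc ↦ ?_) a
    rw [unitsWithOne_succ, H.skew a hu (H.units_mem b hu), ← unitsWithOne_succ A a, hc u hu,
      map_smul, key c hc0, smul_zero, neg_zero]

end QuaternionHermitianOn

theorem contDiffAt_unitsWithOne {y₀ : E} {A : Fin 3 → E → E →L[ℝ] E}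
    (hA : ∀ a, ContDiffAt ℝ ∞ (A a) y₀) {u : E → E} (hu : ContDiffAt ℝ ∞ u y₀) (a : Fin 4) :
    ContDiffAt ℝ ∞ (fun y ↦ unitsWithOne (fun a ↦ A a y) a (u y)) y₀ := by
  refine Fin.cases hu (fun a ↦ (hA a).clm_apply hu) a

/-- Quaternionic Gram-Schmidt process: a subbundle of rank `4p` with a Hermitian quaternionic
structure has a smooth local orthonormal frame made of `p` quaternionic lines. -/
theorem exists_adapted_frame {y₀ : E} {h : E → E →L[ℝ] E →L[ℝ] ℝ} {A : Fin 3 → E → E →L[ℝ] E}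
    {D : E → Submodule ℝ E} (hh : ContDiffAt ℝ ∞ h y₀) (hA : ∀ a, ContDiffAt ℝ ∞ (A a) y₀)
    (H : ∀ᶠ y in 𝓝 y₀, QuaternionHermitianOn (h y) (fun a ↦ A a y) (D y)) {p : ℕ}
    {X : Fin (4 * p) → E → E} (hX : ∀ i, ContDiffAt ℝ ∞ (X i) y₀)
    (hXD : ∀ᶠ y in 𝓝 y₀, LinearIndependent ℝ (fun i ↦ X i y) ∧
      D y = Submodule.span ℝ (range fun i ↦ X i y)) {k : ℕ} (hk : k ≤ p) :
    ∃ u : Fin k → E → E, (∀ j, ContDiffAt ℝ ∞ (u j) y₀) ∧ ∀ᶠ y in 𝓝 y₀, (∀ j, u j y ∈ D y) ∧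
      ∀ i i' : Fin 4 × Fin k, h y (unitsWithOne (fun a ↦ A a y) i.1 (u i.2 y))
        (unitsWithOne (fun a ↦ A a y) i'.1 (u i'.2 y)) = if i = i' then 1 else 0 := by
  induction k with
  | zero => exact ⟨fun j ↦ j.elim0, fun j ↦ j.elim0, .of_forall fun y ↦
      ⟨fun j ↦ j.elim0, fun i ↦ i.2.elim0⟩⟩
  | succ k ih =>
    obtain ⟨u, hu, hu'⟩ := ih (by omega)
    let q : Fin 4 × Fin k → E → E := fun i y ↦ unitsWithOne (fun a ↦ A a y) i.1 (u i.2 y)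
    have hq (i) : ContDiffAt ℝ ∞ (q i) y₀ := contDiffAt_unitsWithOne hA (hu i.2) i.1
    -- The 4k vectors already found cannot span the fibre at y₀, which has dimension 4p > 4k.
    obtain ⟨l, hl⟩ : ∃ l, X l y₀ ∉ Submodule.span ℝ (range fun i ↦ q i y₀) := by
      by_contra! hcon
      have h1 : Submodule.span ℝ (range fun i ↦ X i y₀) ≤
          Submodule.span ℝ (range fun i ↦ q i y₀) := by
        rw [Submodule.span_le]
        rintro _ ⟨i, rfl⟩
        exact hcon i
      have := FiniteDimensional.span_of_finite ℝ (Set.finite_range fun i ↦ q i y₀)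
      have h2 := Submodule.finrank_mono h1
      have h3 := finrank_range_le_card (R := ℝ) (fun i ↦ q i y₀)
      rw [finrank_span_eq_card hXD.self_of_nhds.1] at h2
      simp only [Set.finrank, Fintype.card_prod, Fintype.card_fin] at h2 h3
      omega
    -- The index l is fixed at y₀. Removing the projection onto the previous quaternionic lines
    -- leaves a field nonzero at y₀, hence nonzero nearby, and it can be normalized smoothly.
    let v : E → E := fun y ↦ X l y - ∑ i, h y (X l y) (q i y) • q i y
    have hv : ContDiffAt ℝ ∞ v y₀ := (hX l).sub <| ContDiffAt.sum fun i _ ↦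
      ((hh.clm_apply (hX l)).clm_apply (hq i)).smul (hq i)
    have hv0 : v y₀ ≠ 0 := by
      intro h0
      apply hl
      rw [sub_eq_zero.1 h0]
      exact Submodule.sum_mem _ fun i _ ↦ Submodule.smul_mem _ _ (Submodule.subset_span ⟨i, rfl⟩)
    let r : E → ℝ := fun y ↦ h y (v y) (v y)
    have hr : ContDiffAt ℝ ∞ r y₀ := (hh.clm_apply hv).clm_apply hv
    have hr0 : 0 < r y₀ := H.self_of_nhds.pos _ hv0
    have hev : ∀ᶠ y in 𝓝 y₀, 0 < r y := hr.continuousAt.eventually_const_lt hr0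
    let w : E → E := fun y ↦ (√(r y))⁻¹ • v y
    have hw : ContDiffAt ℝ ∞ w y₀ :=
      (((hr.sqrt hr0.ne')).inv (Real.sqrt_ne_zero'.2 hr0)).smul hv
    refine ⟨Fin.cons w u, fun j ↦ Fin.cases hw hu j, ?_⟩
    filter_upwards [hu', hev, H, hXD] with y ⟨hy1, hy2⟩ hy3 hy4 ⟨_, hy5⟩
    have hvD : v y ∈ D y := by
      refine Submodule.sub_mem _ ?_ (Submodule.sum_mem _ fun i _ ↦ Submodule.smul_mem _ _ ?_)
      · rw [hy5]
        exact Submodule.subset_span ⟨l, rfl⟩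
      · exact hy4.units_mem _ (hy1 _)
    have hwD : w y ∈ D y := Submodule.smul_mem _ _ hvD
    have hvq (i) : h y (v y) (q i y) = 0 := by
      have h2 (i') : h y (q i' y) (q i y) = if i' = i then 1 else 0 := hy2 i' i
      simp [v, h2]
    have hwq (j : Fin k) (a b : Fin 4) : h y (unitsWithOne (fun a ↦ A a y) a (w y))
        (unitsWithOne (fun a ↦ A a y) b (u j y)) = 0 := by
      refine hy4.inner_units_units hwD (hy1 j) (fun c ↦ ?_) a b
      have := hvq (c, j)
      simp only [q] at this
      simp [w, this]
    have hww : h y (w y) (w y) = 1 := by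
      have h1 : r y = √(r y) * √(r y) := (Real.mul_self_sqrt hy3.le).symm
      have h2 : √(r y) ≠ 0 := Real.sqrt_ne_zero'.2 hy3
      have h3 : h y (w y) (w y) = (√(r y))⁻¹ * ((√(r y))⁻¹ * r y) := by simp [w, r]
      rw [h3]
      nth_rewrite 3 [h1]
      field_simp
    refine ⟨fun j ↦ Fin.cases hwD hy1 j, ?_⟩
    rintro ⟨a, j⟩ ⟨b, j'⟩
    refine Fin.cases ?_ (fun j ↦ ?_) j <;> refine Fin.cases ?_ (fun j' ↦ ?_) j'
    · simp [hy4.inner_units_self hwD, hww]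
    · simpa [Fin.ext_iff] using hwq j' a b
    · rw [hy4.symm]
      simpa [Fin.ext_iff] using hwq j b a
    · simpa using hy2 (a, j) (b, j')

end Frame

/-! ### Exterior derivative of a wedge product of 1-forms. -/

section Wedge

variable {E : Type*} [NormedAddCommGroup E] [NormedSpace ℝ E]

/-- The wedge product of linear forms as a continuous multilinear map. -/
def wedgeMultilinear (E : Type*) [NormedAddCommGroup E] [NormedSpace ℝ E] (k : ℕ) :
    ContinuousMultilinearMap ℝ (fun _ : Fin k ↦ E →L[ℝ] ℝ) (E [⋀^Fin k]→L[ℝ] ℝ) :=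
  MultilinearMap.mkContinuous
    { toFun := wedge
      map_update_add' := by
        intro _ θ i α β
        ext v
        have key (γ : E →L[ℝ] ℝ) : (Matrix.of fun a j ↦ Function.update θ i γ a (v j)) =
            (Matrix.of fun a j ↦ θ a (v j)).updateRow i fun j ↦ γ (v j) := by
          ext a j
          by_cases h : a = i
          · subst h; simp
          · simp [h]
        convert! Matrix.det_updateRow_add (Matrix.of fun a j ↦ θ a (v j)) i (fun j ↦ α (v j))
          (fun j ↦ β (v j)) using 1
        · rw [wedge_apply]
          convert! congrArg Matrix.det (key (α + β))
        · rw [ContinuousAlternatingMap.add_apply, wedge_apply, wedge_apply]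
          convert! congrArg₂ (· + ·) (congrArg Matrix.det (key α)) (congrArg Matrix.det (key β))
      map_update_smul' := by
        intro _ θ i c β
        ext v
        have key (γ : E →L[ℝ] ℝ) : (Matrix.of fun a j ↦ Function.update θ i γ a (v j)) =
            (Matrix.of fun a j ↦ θ a (v j)).updateRow i fun j ↦ γ (v j) := by
          ext a j
          by_cases h : a = i
          · subst h; simp
          · simp [h]
        convert! Matrix.det_updateRow_smul (Matrix.of fun a j ↦ θ a (v j)) i c
          (fun j ↦ β (v j)) using 1
        · rw [wedge_apply]
          convert! congrArg Matrix.det (key (c • β))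
        · rw [ContinuousAlternatingMap.smul_apply, wedge_apply, smul_eq_mul]
          convert! congrArg (c * ·) (congrArg Matrix.det (key β)) }
    -- The bound k! counts the terms of the Leibniz expansion of the determinant.
    (k.factorial : ℝ) (by
      intro θ
      refine ContinuousAlternatingMap.opNorm_le_bound _ (by positivity) fun v ↦ ?_
      change ‖wedge θ v‖ ≤ _
      rw [wedge_apply, Matrix.det_apply]
      refine (norm_sum_le _ _).trans ?_
      calc _ ≤ ∑ _σ : Equiv.Perm (Fin k), (∏ i, ‖θ i‖) * ∏ i, ‖v i‖ := by
            refine Finset.sum_le_sum fun σ _ ↦ ?_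
            rw [Units.smul_def, zsmul_eq_mul, norm_mul, norm_prod]
            have h1 : ‖(((Equiv.Perm.sign σ : ℤˣ) : ℤ) : ℝ)‖ = 1 := by
              rcases Int.units_eq_one_or (Equiv.Perm.sign σ) with h | h <;> simp [h]
            rw [h1, one_mul, ← Equiv.prod_comp σ fun i ↦ ‖θ i‖, ← Finset.prod_mul_distrib]
            exact Finset.prod_le_prod (fun _ _ ↦ norm_nonneg _) fun i _ ↦
              (θ (σ i)).le_opNorm (v i)
        _ = _ := by
            simp [Fintype.card_perm, mul_assoc])

@[simp] theorem wedgeMultilinear_apply {k : ℕ} (θ : Fin k → E →L[ℝ] ℝ) :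
    wedgeMultilinear E k θ = wedge θ := rfl

theorem ContDiffAt.wedge {F : Type*} [NormedAddCommGroup F] [NormedSpace ℝ F] {k : ℕ}
    {θ : Fin k → F → E →L[ℝ] ℝ} {y : F} {r : WithTop ℕ∞} (hθ : ∀ i, ContDiffAt ℝ r (θ i) y) :
    ContDiffAt ℝ r (fun y ↦ wedge fun i ↦ θ i y) y :=
  (wedgeMultilinear E k).contDiff.contDiffAt.comp y (contDiffAt_pi.2 hθ)

theorem fderiv_wedge {k : ℕ} {θ : Fin k → E → E →L[ℝ] ℝ} {y : E}
    (hθ : ∀ i, DifferentiableAt ℝ (θ i) y) (t : E) (v : Fin k → E) :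
    DifferentiableAt ℝ (fun y ↦ wedge fun i ↦ θ i y) y ∧
    fderiv ℝ (fun y ↦ wedge (fun i ↦ θ i y) v) y t =
      ∑ i, wedge (Function.update (fun i ↦ θ i y) i (fderiv ℝ (θ i) y t)) v := by
  have h := HasFDerivAt.multilinear_comp (wedgeMultilinear E k) fun i ↦ (hθ i).hasFDerivAt
  refine ⟨h.differentiableAt, ?_⟩
  have h2 := h.continuousAlternatingMap_apply_const v
  refine (congrArg (fun L : E →L[ℝ] ℝ ↦ L t) h2.fderiv).trans ?_
  simp [ContinuousAlternatingMap.sum_apply]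

theorem wedge_vecCons {V : Type*} [AddCommGroup V] [Module ℝ V] [TopologicalSpace V] {k : ℕ}
    (α : Fin (k + 1) → V →L[ℝ] ℝ) (z : V) (u : Fin k → V) :
    wedge α (Matrix.vecCons z u) =
      ∑ i : Fin (k + 1), (-1) ^ (i : ℕ) * α i z * wedge (fun j ↦ α (i.succAbove j)) u := by
  rw [wedge_apply, Matrix.det_succ_column_zero]
  simp_rw [wedge_apply]
  rfl

/-- In the Laplace expansion along the column of z, the replaced form is the only one that can be
nonzero on z. -/
theorem wedge_update_vecCons {V : Type*} [AddCommGroup V] [Module ℝ V] [TopologicalSpace V]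
    {k : ℕ} {α : Fin (k + 1) → V →L[ℝ] ℝ} {z : V} (hz : ∀ i, α i z = 0) (β : V →L[ℝ] ℝ)
    (i : Fin (k + 1)) (u : Fin k → V) :
    wedge (Function.update α i β) (Matrix.vecCons z u) =
      (-1) ^ (i : ℕ) * β z * wedge (fun j ↦ α (i.succAbove j)) u := by
  rw [wedge_vecCons, Finset.sum_eq_single i]
  · simp
  · intro j _ hj
    simp [hj, hz]
  · simp

theorem wedge_vecCons_eq_zero {V : Type*} [AddCommGroup V] [Module ℝ V] [TopologicalSpace V]
    {k : ℕ} {α : Fin (k + 1) → V →L[ℝ] ℝ} {z : V} (hz : ∀ i, α i z = 0) (u : Fin k → V) :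
    wedge α (Matrix.vecCons z u) = 0 := by
  rw [wedge_vecCons]
  simp [hz]

theorem removeNth_succ_vecCons {α : Type*} {k : ℕ} (j : Fin (k + 1)) (a : α) (u : Fin (k + 1) → α) :
    j.succ.removeNth (Matrix.vecCons a u) = Matrix.vecCons a (j.removeNth u) := by
  ext i
  refine Fin.cases ?_ (fun i ↦ ?_) i
  · simp [Fin.removeNth]
  · simp [Fin.removeNth]

/-- The form `θ¹ ∧ ⋯ ∧ θⁿ` is closed at a point where `dθⁱ(z, z') = 0` and `∑ dθⁱ(z, eᵢ) = 0`, for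
all `z`, `z'` killed by the `θⁱ` and `(eᵢ)` a dual family. -/
theorem extDeriv_wedge_eq_zero {m : ℕ} {θ : Fin (m + 1) → E → E →L[ℝ] ℝ} {y : E}
    {e : Fin (m + 1) → E} (hθ : ∀ i, DifferentiableAt ℝ (θ i) y)
    (hd : ∀ i j, θ i y (e j) = if i = j then 1 else 0)
    (h1 : ∀ z z', (∀ i, θ i y z = 0) → (∀ i, θ i y z' = 0) →
      ∀ i, fderiv ℝ (θ i) y z z' = fderiv ℝ (θ i) y z' z)
    (h2 : ∀ z, (∀ i, θ i y z = 0) →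
      ∑ i, (fderiv ℝ (θ i) y z (e i) - fderiv ℝ (θ i) y (e i) z) = 0) :
    extDeriv (fun y ↦ wedge fun i ↦ θ i y) y = 0 := by
  have hdiff := (fderiv_wedge hθ 0 0).1
  apply ContinuousAlternatingMap.toAlternatingMap_injective
  refine alternating_eq_zero_of_contractions (e := e) (θ := fun i ↦ (θ i y : E →ₗ[ℝ] ℝ)) hd _
    (fun z z' hz hz' v ↦ ?_) fun z hz ↦ ?_
  · change extDeriv (fun y ↦ wedge fun i ↦ θ i y) y _ = 0
    rw [extDeriv_apply hdiff]
    rw [Fin.sum_univ_succ, Fin.sum_univ_succ]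
    simp only [(fderiv_wedge hθ _ _).2]
    have h3 : ∀ l : Fin m, ((l.succ.succ : Fin (m + 2)).removeNth
        (Matrix.vecCons z (Matrix.vecCons z' v))) = Matrix.vecCons z (l.succ.removeNth
          (Matrix.vecCons z' v)) := fun l ↦ removeNth_succ_vecCons _ _ _
    have h4 : ((0 : Fin (m + 1)).succ.removeNth
        (Matrix.vecCons z (Matrix.vecCons z' v))) = Matrix.vecCons z v := by
      rw [removeNth_succ_vecCons]
      rfl
    have h5 : ((0 : Fin (m + 2)).removeNth
        (Matrix.vecCons z (Matrix.vecCons z' v))) = Matrix.vecCons z' v := rfl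
    rw [h4, h5]
    simp only [h3, wedge_update_vecCons hz, wedge_update_vecCons hz']
    -- Differentiation along one of the vectors v keeps both z and z' as arguments but alters a
    -- single factor. That factor must absorb z, and the unaltered ones kill z'.
    have h6 : ∀ l : Fin m, ∀ i : Fin (m + 1), wedge (fun j ↦ θ (i.succAbove j) y)
        (l.succ.removeNth (Matrix.vecCons z' v)) = 0 := by
      intro l i
      obtain _ | m := m
      · exact l.elim0
      · rw [removeNth_succ_vecCons]
        exact wedge_vecCons_eq_zero (fun j ↦ hz' _) _
    simp only [h6]
    simp [h1 z z' hz hz']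
  · change extDeriv (fun y ↦ wedge fun i ↦ θ i y) y _ = 0
    rw [extDeriv_apply hdiff]
    simp only [(fderiv_wedge hθ _ _).2]
    rw [Fin.sum_univ_succ, ← h2 z hz, Finset.sum_sub_distrib, sub_eq_add_neg,
      ← Finset.sum_neg_distrib]
    congr 1
    · change (-1) ^ (0 : ℕ) • ∑ i, wedge (Function.update (fun i ↦ θ i y) i
        (fderiv ℝ (θ i) y z)) e = _
      rw [pow_zero, one_smul]
      refine Finset.sum_congr rfl fun i _ ↦ ?_
      rw [wedge_apply]
      have : (Matrix.of fun a j ↦ Function.update (fun i ↦ θ i y) i (fderiv ℝ (θ i) y z) a (e j)) =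
          (1 : Matrix (Fin (m + 1)) (Fin (m + 1)) ℝ).updateRow i
            fun j ↦ fderiv ℝ (θ i) y z (e j) := by
        ext a j
        by_cases h : a = i
        · subst h; simp
        · simp [h, hd, Matrix.one_apply]
      -- The identity matrix with row i replaced has as determinant the i-th entry of the new row.
      rw [this, ← Matrix.cramer_transpose_apply]
      simp
    · refine Finset.sum_congr rfl fun j _ ↦ ?_
      simp only [removeNth_succ_vecCons, wedge_update_vecCons hz]
      rw [Finset.sum_eq_single j]
      · have : wedge (fun i ↦ θ (j.succAbove i) y) (j.removeNth e) = 1 := by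
          rw [wedge_apply, ← Matrix.det_one (n := Fin m)]
          congr 1
          ext a b
          simp [Fin.removeNth, hd, Matrix.one_apply]
        rw [this]
        -- The sign (-1)^(j+1) of the exterior derivative meets the sign (-1)^j of the Laplace
        -- expansion, leaving -1.
        rcases Nat.even_or_odd (j : ℕ) with h | h <;> simp [pow_succ, h.neg_one_pow]
      · intro k _ hk
        have : wedge (fun i ↦ θ (k.succAbove i) y) (j.removeNth e) = 0 := by
          obtain ⟨a, ha⟩ := Fin.exists_succAbove_eq (Ne.symm hk)
          rw [wedge_apply]
          refine Matrix.det_eq_zero_of_row_eq_zero a fun b ↦ ?_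
          simp [Fin.removeNth, hd, ha]
        rw [this, mul_zero]
      · simp

end Wedge

/-! ### From the Kähler form to the volume form of the distribution. -/

section TwoForm

variable {E : Type*} [NormedAddCommGroup E] [NormedSpace ℝ E]

/-- The exterior derivative of a 2-form `Ω`, evaluated on three constant vector fields. -/
def twoFormDeriv (Ω : E → E → E → ℝ) (y t u v : E) : ℝ :=
  fderiv ℝ (fun x ↦ Ω x u v) y t + fderiv ℝ (fun x ↦ Ω x v t) y u + fderiv ℝ (fun x ↦ Ω x t u) y v

/-- If `Ω = ∑ εᵢ θⁱ ⊗ θ^{σ i}` is a 2-form whose exterior derivative vanishes on suitable triples of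
vectors, then `θ¹ ∧ ⋯ ∧ θⁿ` is closed. -/
theorem extDeriv_wedge_eq_zero_of_twoForm {m : ℕ} {θ : Fin (m + 1) → E → E →L[ℝ] ℝ} {y : E}
    {e : Fin (m + 1) → E} (hθ : ∀ i, DifferentiableAt ℝ (θ i) y)
    (hd : ∀ i j, θ i y (e j) = if i = j then 1 else 0)
    {σ : Fin (m + 1) → Fin (m + 1)} (hσ : Function.Involutive σ) {ε : Fin (m + 1) → ℝ}
    (hε : ∀ i, ε i ≠ 0) (hεσ : ∀ i, ε (σ i) = -ε i) {Ω : E → E → E → ℝ}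
    (hΩ : ∀ᶠ x in 𝓝 y, ∀ u v, Ω x u v = ∑ i, ε i * (θ i x u * θ (σ i) x v))
    (h1 : ∀ z z' x, (∀ i, θ i y z = 0) → (∀ i, θ i y z' = 0) → twoFormDeriv Ω y z z' x = 0)
    (h2 : ∀ z i, (∀ i, θ i y z = 0) → twoFormDeriv Ω y z (e i) (e (σ i)) = 0) :
    extDeriv (fun y ↦ wedge fun i ↦ θ i y) y = 0 := by
  have hD (t u v : E) : fderiv ℝ (fun x ↦ Ω x u v) y t =
      ∑ i, ε i * (fderiv ℝ (θ i) y t u * θ (σ i) y v + θ i y u * fderiv ℝ (θ (σ i)) y t v) := by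
    have e1 : (fun x ↦ Ω x u v) =ᶠ[𝓝 y] fun x ↦ ∑ i, ε i * (θ i x u * θ (σ i) x v) := by
      filter_upwards [hΩ] with x hx using hx u v
    have e2 : HasFDerivAt (fun x ↦ ∑ i, ε i * (θ i x u * θ (σ i) x v))
        (∑ i, ε i • (θ i y u • (fderiv ℝ (θ (σ i)) y).flip v +
          θ (σ i) y v • (fderiv ℝ (θ i) y).flip u)) y := by
      refine HasFDerivAt.fun_sum fun i _ ↦ HasFDerivAt.const_mul ?_ _
      have f1 (j : Fin (m + 1)) (w : E) :
          HasFDerivAt (fun x ↦ θ j x w) ((fderiv ℝ (θ j) y).flip w) y := by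
        have := (hθ j).hasFDerivAt.clm_apply (hasFDerivAt_const w y)
        simpa using this
      exact (f1 i u).mul (f1 (σ i) v)
    rw [e1.fderiv_eq, e2.fderiv]
    simp only [sum_apply, smul_apply, add_apply, ContinuousLinearMap.flip_apply, smul_eq_mul]
    exact Finset.sum_congr rfl fun i _ ↦ by ring
  refine extDeriv_wedge_eq_zero hθ hd (fun z z' hz hz' i ↦ ?_) fun z hz ↦ ?_
  -- Testing dΩ on (z, z', e_{σi}) isolates εᵢ dθⁱ(z,z'): the term of index i and the term of index
  -- σi, with ε_{σi} = -εᵢ, are the only survivors.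
  · have := h1 z z' (e (σ i)) hz hz'
    simp only [twoFormDeriv, hD, hz, hz', hd, hσ.injective.eq_iff] at this
    have h3 : ∀ j, (j = σ i) = (σ j = i) := fun j ↦ by
      refine propext ⟨fun h ↦ by rw [h, hσ], fun h ↦ by rw [← h, hσ]⟩
    simp only [h3, mul_ite, ite_mul, mul_zero, zero_mul, zero_add, add_zero, one_mul, mul_one,
      Finset.sum_const_zero, Finset.sum_ite_eq', Finset.mem_univ, if_true] at this
    rw [Finset.sum_eq_single (σ i)] at this
    · rw [if_pos (hσ i), hεσ, hσ] at this
      have h4 : ε i * (fderiv ℝ (θ i) y z z' - fderiv ℝ (θ i) y z' z) = 0 := by linarith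
      exact sub_eq_zero.1 ((mul_eq_zero.1 h4).resolve_left (hε i))
    · intro j _ hj
      rw [if_neg]
      intro h
      exact hj (by rw [← h, hσ])
    · simp
  -- Testing dΩ on (z, eᵢ, e_{σi}) gives εᵢ times the sum for the pair {i, σi}. Summed over i, every
  -- index occurs twice.
  · have key (i : Fin (m + 1)) : (fderiv ℝ (θ i) y z (e i) - fderiv ℝ (θ i) y (e i) z) +
        (fderiv ℝ (θ (σ i)) y z (e (σ i)) - fderiv ℝ (θ (σ i)) y (e (σ i)) z) = 0 := by
      have := h2 z i hz
      have h3 : ∀ j, (j = σ i) = (σ j = i) := fun j ↦ by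
        refine propext ⟨fun h ↦ by rw [h, hσ], fun h ↦ by rw [← h, hσ]⟩
      simp only [twoFormDeriv, hD, hz, hd, hσ.injective.eq_iff, mul_ite, ite_mul, mul_zero,
        zero_mul, zero_add, add_zero, one_mul, mul_one, mul_add, Finset.sum_add_distrib,
        Finset.sum_ite_eq', Finset.mem_univ, if_true] at this
      simp only [← h3, Finset.sum_ite_eq', Finset.mem_univ, if_true, hσ i, hεσ] at this
      have h4 : ε i * ((fderiv ℝ (θ i) y z (e i) - fderiv ℝ (θ i) y (e i) z) +
        (fderiv ℝ (θ (σ i)) y z (e (σ i)) - fderiv ℝ (θ (σ i)) y (e (σ i)) z)) = 0 := by linarith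
      exact (mul_eq_zero.1 h4).resolve_left (hε i)
    have h5 := Finset.sum_eq_zero fun i (_ : i ∈ Finset.univ) ↦ key i
    have h6 : ∑ i, (fderiv ℝ (θ (σ i)) y z (e (σ i)) - fderiv ℝ (θ (σ i)) y (e (σ i)) z) =
        ∑ i, (fderiv ℝ (θ i) y z (e i) - fderiv ℝ (θ i) y (e i) z) :=
      Equiv.sum_comp hσ.toPerm fun i ↦ fderiv ℝ (θ i) y z (e i) - fderiv ℝ (θ i) y (e i) z
    rw [Finset.sum_add_distrib, h6] at h5
    linarith

end TwoForm

/-! ### Tangent vectors and vector fields in a chart. -/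

section Chart

variable {F : Type*} [NormedAddCommGroup F] [NormedSpace ℝ F]
variable {N : Type*} [TopologicalSpace N] [ChartedSpace F N] [IsManifold 𝓘(ℝ, F) ∞ N]

/-- The vectors of `T_x N` with given coordinates in the chart at `x₀`. -/
def fromChart (x₀ x : N) : F →L[ℝ] T F x :=
  (trivializationAt F (TangentSpace 𝓘(ℝ, F)) x₀).symmL ℝ x

/-- The coordinates of the vectors of `T_x N` in the chart at `x₀`. -/
def toChart (x₀ x : N) : T F x →L[ℝ] F :=
  (trivializationAt F (TangentSpace 𝓘(ℝ, F)) x₀).continuousLinearMapAt ℝ x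

theorem toChart_fromChart {x₀ x : N} (hx : x ∈ (chartAt F x₀).source) (u : F) :
    toChart x₀ x (fromChart x₀ x u) = u :=
  (trivializationAt F (TangentSpace 𝓘(ℝ, F)) x₀).continuousLinearMapAt_symmL (by simpa using hx) u

theorem fromChart_toChart {x₀ x : N} (hx : x ∈ (chartAt F x₀).source) (v : T F x) :
    fromChart x₀ x (toChart x₀ x v) = v :=
  (trivializationAt F (TangentSpace 𝓘(ℝ, F)) x₀).symmL_continuousLinearMapAt (by simpa using hx) v

theorem toChart_eq_mfderiv {x₀ x : N} (hx : x ∈ (chartAt F x₀).source) :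
    toChart x₀ x = mfderiv 𝓘(ℝ, F) 𝓘(ℝ, F) (extChartAt 𝓘(ℝ, F) x₀) x :=
  TangentBundle.continuousLinearMapAt_trivializationAt hx

theorem fromChart_eq_mfderiv {x₀ : N} {q : F} (hq : q ∈ (extChartAt 𝓘(ℝ, F) x₀).target) :
    fromChart (F := F) x₀ ((extChartAt 𝓘(ℝ, F) x₀).symm q) =
      mfderiv 𝓘(ℝ, F) 𝓘(ℝ, F) (extChartAt 𝓘(ℝ, F) x₀).symm q := by
  have h1 : (extChartAt 𝓘(ℝ, F) x₀).symm q ∈ (chartAt F x₀).source := by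
    simpa using (extChartAt 𝓘(ℝ, F) x₀).map_target hq
  have h2 := TangentBundle.symmL_trivializationAt (I := 𝓘(ℝ, F)) h1
  rw [(extChartAt 𝓘(ℝ, F) x₀).right_inv hq] at h2
  simp only [modelWithCornersSelf_coe, range_id, mfderivWithin_univ] at h2
  exact h2

omit [IsManifold 𝓘(ℝ, F) ∞ N] in
theorem eventually_mem_target {x₀ x : N} (hx : x ∈ (chartAt F x₀).source) :
    ∀ᶠ q in 𝓝 (extChartAt 𝓘(ℝ, F) x₀ x), q ∈ (extChartAt 𝓘(ℝ, F) x₀).target :=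
  (isOpen_extChartAt_target x₀).mem_nhds ((extChartAt 𝓘(ℝ, F) x₀).map_source (by simpa using hx))

/-- A vector field is smooth at a point if its coordinates are. -/
theorem contMDiffAt_field_iff {x₀ x : N} (hx : x ∈ (chartAt F x₀).source) {X : ∀ x : N, T F x} :
    ContMDiffAt 𝓘(ℝ, F) (𝓘(ℝ, F).prod 𝓘(ℝ, F)) ∞
      (fun x ↦ TotalSpace.mk' F (E := fun y : N ↦ T F y) x (X x)) x ↔
    ContMDiffAt 𝓘(ℝ, F) 𝓘(ℝ, F) ∞ (fun x ↦ toChart x₀ x (X x)) x := by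
  have h := (trivializationAt F (TangentSpace 𝓘(ℝ, F)) x₀).contMDiffAt_section_iff
    (IB := 𝓘(ℝ, F)) (n := ∞) (s := X) (x₀ := x) (by simpa using hx)
  refine h.trans (Filter.EventuallyEq.contMDiffAt_iff ?_)
  filter_upwards [(chartAt F x₀).open_source.mem_nhds hx] with z hz
  exact ((trivializationAt F (TangentSpace 𝓘(ℝ, F)) x₀).continuousLinearMapAt_apply_of_mem
    (R := ℝ) (by simpa using hz) (X z)).symm

theorem contMDiffAt_fromChart {x₀ x : N} (hx : x ∈ (chartAt F x₀).source) (u : F) :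
    ContMDiffAt 𝓘(ℝ, F) (𝓘(ℝ, F).prod 𝓘(ℝ, F)) ∞
      (fun x ↦ TotalSpace.mk' F (E := fun y : N ↦ T F y) x (fromChart x₀ x u)) x := by
  rw [contMDiffAt_field_iff hx]
  refine (contMDiffAt_const (c := u)).congr_of_eventuallyEq ?_
  filter_upwards [(chartAt F x₀).open_source.mem_nhds hx] with z hz
  exact toChart_fromChart hz u

theorem ContMDiffAt.contDiffAt_comp_extChartAt_symm {x₀ x : N} (hx : x ∈ (chartAt F x₀).source)
    {G : Type*} [NormedAddCommGroup G] [NormedSpace ℝ G] {f : N → G}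
    (hf : ContMDiffAt 𝓘(ℝ, F) 𝓘(ℝ, G) ∞ f x) :
    ContDiffAt ℝ ∞ (fun q ↦ f ((extChartAt 𝓘(ℝ, F) x₀).symm q)) (extChartAt 𝓘(ℝ, F) x₀ x) := by
  rw [← contMDiffAt_iff_contDiffAt]
  have hx' : x ∈ (extChartAt 𝓘(ℝ, F) x₀).source := by simpa using hx
  refine ContMDiffAt.comp (I' := 𝓘(ℝ, F)) (extChartAt 𝓘(ℝ, F) x₀ x) ?_ ?_
  · rwa [(extChartAt 𝓘(ℝ, F) x₀).left_inv hx']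
  · exact (contMDiffOn_extChartAt_symm x₀).contMDiffAt
      (eventually_mem_target hx)

/-- The derivative of a function on the manifold along a vector given by its coordinates. -/
theorem mvfderiv_fromChart {x₀ x : N} (hx : x ∈ (chartAt F x₀).source) {f : N → ℝ}
    (hf : MDifferentiableAt 𝓘(ℝ, F) 𝓘(ℝ, ℝ) f x) (u : F) :
    DifferentiableAt ℝ (fun q ↦ f ((extChartAt 𝓘(ℝ, F) x₀).symm q)) (extChartAt 𝓘(ℝ, F) x₀ x) ∧
    mvfderiv 𝓘(ℝ, F) f x (fromChart x₀ x u) =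
      fderiv ℝ (fun q ↦ f ((extChartAt 𝓘(ℝ, F) x₀).symm q)) (extChartAt 𝓘(ℝ, F) x₀ x) u := by
  have hx' : x ∈ (extChartAt 𝓘(ℝ, F) x₀).source := by simpa using hx
  set q := extChartAt 𝓘(ℝ, F) x₀ x with hq
  have hqt : q ∈ (extChartAt 𝓘(ℝ, F) x₀).target := (extChartAt 𝓘(ℝ, F) x₀).map_source hx'
  have hxq : (extChartAt 𝓘(ℝ, F) x₀).symm q = x := (extChartAt 𝓘(ℝ, F) x₀).left_inv hx'
  clear_value q
  subst hxq
  have h1 : MDifferentiableAt 𝓘(ℝ, F) 𝓘(ℝ, F) (extChartAt 𝓘(ℝ, F) x₀).symm q :=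
    ((contMDiffOn_extChartAt_symm x₀).contMDiffAt
      ((isOpen_extChartAt_target x₀).mem_nhds hqt)).mdifferentiableAt (n := ∞) (by simp)
  have h2 := hf.comp q h1
  refine ⟨mdifferentiableAt_iff_differentiableAt.1 h2, ?_⟩
  rw [fromChart_eq_mfderiv hqt]
  have h3 := mfderiv_comp q hf h1
  rw [mfderiv_eq_fderiv] at h3
  exact (congrArg (fun L : F →L[ℝ] ℝ ↦ L u) h3).symm

theorem lieBracketWithin_eq_zero_of_const {V W : F → F} {s : Set F} {q u v : F}
    (hs : s = univ) (hV : V =ᶠ[𝓝 q] fun _ ↦ u) (hW : W =ᶠ[𝓝 q] fun _ ↦ v) :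
    VectorField.lieBracketWithin ℝ V W s q = 0 := by
  rw [hs, VectorField.lieBracketWithin_univ, hV.lieBracket_vectorField_eq hW]
  simp [VectorField.lieBracket]

/-- The Lie bracket of two coordinate vector fields is zero. -/
theorem mlieBracket_fromChart (x₀ : N) (u v : F) :
    VectorField.mlieBracket 𝓘(ℝ, F) (fun x ↦ fromChart x₀ x u) (fun x ↦ fromChart x₀ x v) x₀ = 0 := by
  -- Read in the chart, a coordinate vector field is constant, and constant fields commute.
  have key (w : F) : VectorField.mpullbackWithin 𝓘(ℝ, F) 𝓘(ℝ, F) (extChartAt 𝓘(ℝ, F) x₀).symm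
      (fun x ↦ fromChart x₀ x w) (range 𝓘(ℝ, F)) =ᶠ[𝓝 (extChartAt 𝓘(ℝ, F) x₀ x₀)] fun _ ↦ w := by
    filter_upwards [eventually_mem_target (mem_chart_source F x₀)] with q hq
    rw [VectorField.mpullbackWithin_apply, fromChart_eq_mfderiv hq]
    have h1 := isInvertible_mfderivWithin_extChartAt_symm (I := 𝓘(ℝ, F)) hq
    simp only [modelWithCornersSelf_coe, range_id, mfderivWithin_univ] at h1 ⊢
    exact h1.inverse_apply_eq.2 rfl
  rw [← VectorField.mlieBracketWithin_univ, VectorField.mlieBracketWithin_apply]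
  simp only [preimage_univ, univ_inter]
  have h0 : VectorField.lieBracketWithin ℝ
      (VectorField.mpullbackWithin 𝓘(ℝ, F) 𝓘(ℝ, F) (extChartAt 𝓘(ℝ, F) x₀).symm
        (fun x ↦ fromChart x₀ x u) (range 𝓘(ℝ, F)))
      (VectorField.mpullbackWithin 𝓘(ℝ, F) 𝓘(ℝ, F) (extChartAt 𝓘(ℝ, F) x₀).symm
        (fun x ↦ fromChart x₀ x v) (range 𝓘(ℝ, F))) (range 𝓘(ℝ, F))
      (extChartAt 𝓘(ℝ, F) x₀ x₀) = 0 := by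
    exact lieBracketWithin_eq_zero_of_const (by simp) (key u) (key v)
  rw [h0]
  exact map_zero _

end Chart

/-! ### First-order geometry of the ambient l.c.q.K. manifold. -/

section Ambient

variable {F : Type*} [NormedAddCommGroup F] [NormedSpace ℝ F]
variable {N : Type*} [TopologicalSpace N] [ChartedSpace F N]

theorem eventually_comp_extChartAt_symm {x₀ x : N} (hx : x ∈ (chartAt F x₀).source) {P : N → Prop}
    (h : ∀ᶠ z in 𝓝 x, P z) :
    ∀ᶠ q in 𝓝 (extChartAt 𝓘(ℝ, F) x₀ x), P ((extChartAt 𝓘(ℝ, F) x₀).symm q) := by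
  have hx' : x ∈ (extChartAt 𝓘(ℝ, F) x₀).source := by simpa using hx
  have h1 := continuousAt_extChartAt_symm' (I := 𝓘(ℝ, F)) hx'
  have h2 : (extChartAt 𝓘(ℝ, F) x₀).symm (extChartAt 𝓘(ℝ, F) x₀ x) = x :=
    (extChartAt 𝓘(ℝ, F) x₀).left_inv hx'
  rw [ContinuousAt, h2] at h1
  exact h1.eventually h

theorem fderiv_comp_extChartAt_symm_congr {x₀ x : N} (hx : x ∈ (chartAt F x₀).source)
    {f f' : N → ℝ} (h : f =ᶠ[𝓝 x] f') :
    fderiv ℝ (fun q ↦ f ((extChartAt 𝓘(ℝ, F) x₀).symm q)) (extChartAt 𝓘(ℝ, F) x₀ x) =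
      fderiv ℝ (fun q ↦ f' ((extChartAt 𝓘(ℝ, F) x₀).symm q)) (extChartAt 𝓘(ℝ, F) x₀ x) :=
  Filter.EventuallyEq.fderiv_eq (eventually_comp_extChartAt_symm hx h)

variable [IsManifold 𝓘(ℝ, F) ∞ N]

/-- The inner product of two smooth vector fields is smooth. -/
theorem contMDiffAt_inner (g : ContMDiffRiemannianMetric 𝓘(ℝ, F) ∞ F (fun x : N ↦ T F x)) {x₀ : N}
    {X Y : ∀ x : N, T F x}
    (hX : ContMDiffAt 𝓘(ℝ, F) (𝓘(ℝ, F).prod 𝓘(ℝ, F)) ∞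
      (fun x ↦ TotalSpace.mk' F (E := fun y : N ↦ T F y) x (X x)) x₀)
    (hY : ContMDiffAt 𝓘(ℝ, F) (𝓘(ℝ, F).prod 𝓘(ℝ, F)) ∞
      (fun x ↦ TotalSpace.mk' F (E := fun y : N ↦ T F y) x (Y x)) x₀) :
    ContMDiffAt 𝓘(ℝ, F) 𝓘(ℝ, ℝ) ∞ (fun x ↦ g.inner x (X x) (Y x)) x₀ := by
  have : ContMDiffAt 𝓘(ℝ, F) (𝓘(ℝ, F).prod 𝓘(ℝ)) ∞
      (fun m ↦ TotalSpace.mk' ℝ (E := Bundle.Trivial N ℝ) m (g.inner m (X m) (Y m))) x₀ :=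
    ContMDiffAt.clm_bundle_apply₂ (F₁ := F) (F₂ := F) g.contMDiff.contMDiffAt hX hY
  simp only [contMDiffAt_totalSpace] at this
  exact this.2

theorem contMDiffAt_end_apply {x₀ : N} {J : ∀ x : N, EndT F x} {X : ∀ x : N, T F x}
    (hJ : ContMDiffAt 𝓘(ℝ, F) (𝓘(ℝ, F).prod 𝓘(ℝ, F →L[ℝ] F)) ∞
      (fun x ↦ TotalSpace.mk' (F →L[ℝ] F) (E := fun y : N ↦ EndT F y) x (J x)) x₀)
    (hX : ContMDiffAt 𝓘(ℝ, F) (𝓘(ℝ, F).prod 𝓘(ℝ, F)) ∞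
      (fun x ↦ TotalSpace.mk' F (E := fun y : N ↦ T F y) x (X x)) x₀) :
    ContMDiffAt 𝓘(ℝ, F) (𝓘(ℝ, F).prod 𝓘(ℝ, F)) ∞
      (fun x ↦ TotalSpace.mk' F (E := fun y : N ↦ T F y) x (J x (X x))) x₀ :=
  ContMDiffAt.clm_bundle_apply hJ hX

/-- The first order structure of an l.c.q.K. manifold at a point: the covariant derivative of the
Kähler form of a local almost complex structure `J₀` of `H` with respect to the Levi-Civita
connection of the local conformal quaternion Kähler metric, in the chart at the point. -/
theorem LCQK.exists_first_order (S : LCQK F N) (x₀ : N) :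
    ∃ J : Fin 3 → ∀ x : N, EndT F x,
      (∀ a, ContMDiffAt 𝓘(ℝ, F) (𝓘(ℝ, F).prod 𝓘(ℝ, F →L[ℝ] F)) ∞
        (fun x ↦ TotalSpace.mk' (F →L[ℝ] F) (E := fun y : N ↦ EndT F y) x (J a x)) x₀) ∧
      (∀ᶠ x in 𝓝 x₀, IsQuaternionTriple (fun a ↦ J a x) ∧
        S.H x = Submodule.span ℝ (range fun a ↦ J a x) ∧
        ∀ a v w, S.g.inner x (J a x v) (J a x w) = S.g.inner x v w) ∧
      ∃ (Γ : F → F → T F x₀) (K : F → EndT F x₀), (∀ t u, Γ t u = Γ u t) ∧ (∀ t, K t ∈ S.H x₀) ∧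
        (∀ t w, S.g.inner x₀ (K t w) (J 0 x₀ w) = 0) ∧
        ∀ t u v : F, fderiv ℝ (fun q ↦ S.g.inner ((extChartAt 𝓘(ℝ, F) x₀).symm q)
            (J 0 _ (fromChart x₀ _ u)) (fromChart x₀ _ v)) (extChartAt 𝓘(ℝ, F) x₀ x₀) t =
          S.leeForm x₀ (fromChart x₀ x₀ t) *
              S.g.inner x₀ (J 0 x₀ (fromChart x₀ x₀ u)) (fromChart x₀ x₀ v) +
            S.g.inner x₀ (K t (fromChart x₀ x₀ u)) (fromChart x₀ x₀ v) -
            S.g.inner x₀ (Γ t u) (J 0 x₀ (fromChart x₀ x₀ v)) +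
            S.g.inner x₀ (J 0 x₀ (fromChart x₀ x₀ u)) (Γ t v) := by
  obtain ⟨U₁, hU₁, hx₁, J, hJs, hJ⟩ := S.localBasis x₀
  obtain ⟨U₂, hU₂, hx₂, f, g', hf, hg, hlee, cov, hLC, hP⟩ := S.locallyConformal x₀
  have hsrc := mem_chart_source F x₀
  have hJc (a) := (hJs a).contMDiffAt (hU₁.mem_nhds hx₁)
  let X : F → ∀ x : N, T F x := fun u x ↦ fromChart x₀ x u
  have hX (u) : ContMDiffAt 𝓘(ℝ, F) (𝓘(ℝ, F).prod 𝓘(ℝ, F)) ∞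
      (fun x ↦ TotalSpace.mk' F (E := fun y : N ↦ T F y) x (X u x)) x₀ :=
    contMDiffAt_fromChart hsrc u
  have hXd (u) : DiffFieldAt (X u) x₀ := (hX u).mdifferentiableAt (by simp)
  have hJX (u) := contMDiffAt_end_apply (hJc 0) (hX u)
  have hJXd (u) : DiffFieldAt (fun x ↦ J 0 x (X u x)) x₀ := (hJX u).mdifferentiableAt (by simp)
  have hfc : ContMDiffAt 𝓘(ℝ, F) 𝓘(ℝ, ℝ) ∞ f x₀ := hf.contMDiffAt (hU₂.mem_nhds hx₂)
  have hfd := hfc.mdifferentiableAt (by simp)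
  have hg' : ∀ x ∈ U₂, g' x = Real.exp (-f x) • S.g.inner x := by
    intro x hx
    rw [hg x hx, smul_smul, ← Real.exp_add, neg_add_cancel, Real.exp_zero, one_smul]
  have hg'x : g' x₀ = Real.exp (-f x₀) • S.g.inner x₀ := hg' x₀ hx₂
  have hs {Y Z : ∀ x : N, T F x}
      (hY : ContMDiffAt 𝓘(ℝ, F) (𝓘(ℝ, F).prod 𝓘(ℝ, F)) ∞
        (fun x ↦ TotalSpace.mk' F (E := fun y : N ↦ T F y) x (Y x)) x₀)
      (hZ : ContMDiffAt 𝓘(ℝ, F) (𝓘(ℝ, F).prod 𝓘(ℝ, F)) ∞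
        (fun x ↦ TotalSpace.mk' F (E := fun y : N ↦ T F y) x (Z x)) x₀) :
      MDifferentiableAt 𝓘(ℝ, F) 𝓘(ℝ, ℝ) (fun x ↦ g' x (Y x) (Z x)) x₀ := by
    have h1 := contMDiffAt_inner S.g hY hZ
    have h2 : ContMDiffAt 𝓘(ℝ, F) 𝓘(ℝ, ℝ) ∞ (fun x ↦ Real.exp (-f x)) x₀ :=
      (Real.contDiff_exp.contMDiff.contMDiffAt).comp x₀ hfc.neg
    refine ((h2.mul h1).congr_of_eventuallyEq ?_).mdifferentiableAt (by simp)
    filter_upwards [hU₂.mem_nhds hx₂] with x hx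
    rw [hg' x hx]
    rfl
  refine ⟨J, hJc, ?_, ?_⟩
  · filter_upwards [hU₁.mem_nhds hx₁] with x hx using hJ x hx
  have hH0 : ∀ x ∈ U₁ ∩ U₂, J 0 x ∈ S.H x := by
    intro x hx
    rw [(hJ x hx.1).2.1]
    exact Submodule.subset_span ⟨0, rfl⟩
  -- The endomorphism K t is the covariant derivative of J₀ along t for the local quaternion Kähler
  -- metric; it lies in H because that connection preserves H.
  have hP' (t : F) := hP (U₁ ∩ U₂) (hU₁.inter hU₂) inter_subset_right (J 0)
    ((hJs 0).mono inter_subset_left) hH0 x₀ ⟨hx₁, hx₂⟩ (X t x₀)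
  choose K hK hKeq using hP'
  obtain ⟨hquat, -, horth⟩ := hJ x₀ hx₁
  have hskew (v w : T F x₀) : S.g.inner x₀ (J 0 x₀ v) w = -S.g.inner x₀ v (J 0 x₀ w) := by
    rw [← horth 0 v (J 0 x₀ w), hquat.sq 0 w, map_neg, neg_neg]
  refine ⟨fun t u ↦ cov (X u) x₀ (X t x₀), K, fun t u ↦ ?_, hK, fun t w ↦ ?_, fun t u v ↦ ?_⟩
  · have h1 := hLC.torsionFree (X t) (X u) x₀ hx₂ (hXd t) (hXd u)
    rw [mlieBracket_fromChart] at h1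
    exact sub_eq_zero.1 h1
  -- Differentiating g'(J₀X, J₀X) = g'(X, X) for the coordinate field X through w leaves g'(K_t w,
  -- J₀w) = 0, and g is a multiple of g'.
  · obtain ⟨u, rfl⟩ : ∃ u, X u x₀ = w := ⟨toChart x₀ x₀ w, fromChart_toChart hsrc w⟩
    have h1 := hLC.metric _ _ x₀ (X t x₀) hx₂ (hJXd u) (hJXd u)
    have h2 := hLC.metric _ _ x₀ (X t x₀) hx₂ (hXd u) (hXd u)
    have h3 := (mvfderiv_fromChart hsrc (hs (hJX u) (hJX u)) t).2
    have h4 := (mvfderiv_fromChart hsrc (hs (hX u) (hX u)) t).2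
    have h5 : (fun x ↦ g' x (J 0 x (X u x)) (J 0 x (X u x))) =ᶠ[𝓝 x₀]
        fun x ↦ g' x (X u x) (X u x) := by
      filter_upwards [hU₁.mem_nhds hx₁, hU₂.mem_nhds hx₂] with x hx hx'
      rw [hg' x hx']
      simp only [smul_apply, (hJ x hx).2.2]
    have h6 := fderiv_comp_extChartAt_symm_congr hsrc h5
    rw [← h6, ← h3, h1, h2] at h4
    have h7 := hKeq t (X u) (hXd u)
    rw [sub_eq_iff_eq_add] at h7
    rw [h7, hg'x] at h4
    have h8 : Real.exp (-f x₀) * S.g.inner x₀ (K t (X u x₀)) (J 0 x₀ (X u x₀)) = 0 := by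
      simp only [smul_apply, smul_eq_mul, map_add, add_apply, horth,
        S.g.symm x₀ (J 0 x₀ (X u x₀)) (K t (X u x₀))] at h4
      linarith
    exact (mul_eq_zero.1 h8).resolve_left (Real.exp_pos _).ne'
  -- The product rule for e^f g'(J₀X_u, X_v): the factor e^f contributes the Lee form, and ∇(J₀X_u)
  -- = J₀∇X_u + K X_u gives the rest, with J₀ moved across by skewness.
  · have h1 := hLC.metric _ _ x₀ (X t x₀) hx₂ (hJXd u) (hXd v)
    obtain ⟨h3, h3'⟩ := mvfderiv_fromChart hsrc (hs (hJX u) (hX v)) t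
    obtain ⟨h4, h4'⟩ := mvfderiv_fromChart hsrc hfd t
    have h5 : (fun x ↦ S.g.inner x (J 0 x (X u x)) (X v x)) =ᶠ[𝓝 x₀]
        fun x ↦ Real.exp (f x) * g' x (J 0 x (X u x)) (X v x) := by
      filter_upwards [hU₂.mem_nhds hx₂] with x hx
      rw [hg x hx]
      rfl
    have h6 := fderiv_comp_extChartAt_symm_congr hsrc h5
    have h7 := hKeq t (X u) (hXd u)
    rw [sub_eq_iff_eq_add] at h7
    have h8 := (h4.hasFDerivAt.exp.mul h3.hasFDerivAt).fderiv
    have hx : (extChartAt 𝓘(ℝ, F) x₀).symm (extChartAt 𝓘(ℝ, F) x₀ x₀) = x₀ :=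
      extChartAt_to_inv x₀
    have h9 := congrArg (fun L : F →L[ℝ] ℝ ↦ L t) (h6.trans h8)
    refine h9.trans ?_
    simp only [add_apply, smul_apply, smul_eq_mul]
    rw [← h3', ← h4', hlee x₀ hx₂]
    erw [h1, h7]
    rw [hx, hg'x]
    simp only [smul_apply, smul_eq_mul, map_add, add_apply, hskew (cov (X u) x₀ (X t x₀))]
    have hexp : Real.exp (f x₀) * Real.exp (-f x₀) = 1 := by
      rw [← Real.exp_add, add_neg_cancel, Real.exp_zero]
    have key : ∀ a b c d l r r' : ℝ, r * r' = 1 →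
        r * (r' * a + r' * -b + r' * c) + r' * d * (r * l) = l * d + a - b + c := by
      intro a b c d l r r' h
      linear_combination (a - b + c + d * l) * h
    exact key _ _ _ _ _ _ _ hexp

end Ambient

/-! ### Families of bilinear forms and their pullbacks. -/

section Bilinear

variable {E : Type*} [NormedAddCommGroup E] [NormedSpace ℝ E]
variable {F : Type*} [NormedAddCommGroup F] [NormedSpace ℝ F]

/-- The pullback of a bilinear form by a linear map. -/
def pullForm {V : Type*} [AddCommGroup V] [Module ℝ V] [TopologicalSpace V]
    [IsTopologicalAddGroup V] [ContinuousSMul ℝ V] (b : V →L[ℝ] V →L[ℝ] ℝ) (P : E →L[ℝ] V) :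
    E →L[ℝ] E →L[ℝ] ℝ :=
  (ContinuousLinearMap.precomp ℝ P).comp (b.comp P)

@[simp] theorem pullForm_apply {V : Type*} [AddCommGroup V] [Module ℝ V] [TopologicalSpace V]
    [IsTopologicalAddGroup V] [ContinuousSMul ℝ V] (b : V →L[ℝ] V →L[ℝ] ℝ) (P : E →L[ℝ] V)
    (u v : E) : pullForm b P u v = b (P u) (P v) := rfl

theorem contDiffAt_clm_of_apply [FiniteDimensional ℝ E] {G : Type*} [NormedAddCommGroup G]
    [NormedSpace ℝ G] {f : F → E →L[ℝ] G} {y : F} {n : WithTop ℕ∞}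
    (h : ∀ u, ContDiffAt ℝ n (fun x ↦ f x u) y) : ContDiffAt ℝ n f y := by
  let b := Module.finBasis ℝ E
  have : f = fun x ↦ ∑ i, (ContinuousLinearMap.smulRightL ℝ E G
      (LinearMap.toContinuousLinearMap (b.coord i))) (f x (b i)) := by
    funext x
    ext u
    conv_lhs => rw [← b.sum_repr u]
    simp only [map_sum, map_smul, sum_apply]
    rfl
  rw [this]
  exact ContDiffAt.sum fun i _ ↦ (ContinuousLinearMap.contDiff _).contDiffAt.comp y (h (b i))

theorem contDiffAt_form_of_apply [FiniteDimensional ℝ E] {f : F → E →L[ℝ] E →L[ℝ] ℝ} {y : F}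
    {n : WithTop ℕ∞} (h : ∀ u v, ContDiffAt ℝ n (fun x ↦ f x u v) y) : ContDiffAt ℝ n f y :=
  contDiffAt_clm_of_apply fun u ↦ contDiffAt_clm_of_apply fun v ↦ h u v

/-- A smooth family of bilinear forms is represented, for a smooth family of inner products, by a
smooth family of endomorphisms. -/
theorem exists_endomorphism_of_form [FiniteDimensional ℝ E] {h : E → E →L[ℝ] E →L[ℝ] ℝ} {y : E}
    {n : WithTop ℕ∞} (hh : ContDiffAt ℝ n h y) (hpos : ∀ u, u ≠ 0 → 0 < h y u u)
    {Ω : E → E →L[ℝ] E →L[ℝ] ℝ} (hΩ : ContDiffAt ℝ n Ω y) :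
    ∃ A : E → E →L[ℝ] E, ContDiffAt ℝ n A y ∧ ∀ᶠ x in 𝓝 y, ∀ u v, h x (A x u) v = Ω x u v := by
  have hcont : ContinuousAt h y := hh.continuousAt
  have hinj : Function.Injective (h y : E →ₗ[ℝ] E →L[ℝ] ℝ) := by
    rw [← LinearMap.ker_eq_bot, LinearMap.ker_eq_bot']
    intro u hu
    by_contra h0
    have h1 : h y u u = 0 := congrArg (fun L : E →L[ℝ] ℝ ↦ L u) hu
    exact (hpos u h0).ne' h1
  have hfin : Module.finrank ℝ E = Module.finrank ℝ (E →L[ℝ] ℝ) := by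
    rw [← (LinearMap.toContinuousLinearMap : (E →ₗ[ℝ] ℝ) ≃ₗ[ℝ] (E →L[ℝ] ℝ)).finrank_eq]
    exact Subspace.dual_finrank_eq.symm
  let e : E ≃L[ℝ] (E →L[ℝ] ℝ) :=
    (LinearEquiv.ofInjectiveOfFinrankEq (h y : E →ₗ[ℝ] E →L[ℝ] ℝ) hinj hfin).toContinuousLinearEquiv
  have he : (e : E →L[ℝ] E →L[ℝ] ℝ) = h y := by
    ext u v
    rfl
  have : CompleteSpace E := FiniteDimensional.complete ℝ E
  -- Seen as a map from E to its dual, h is invertible at y, hence nearby, and inversion is smooth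
  -- at invertible maps.
  refine ⟨fun x ↦ (h x).inverse.comp (Ω x), ?_, ?_⟩
  · have h1 : ContDiffAt ℝ n (ContinuousLinearMap.inverse : (E →L[ℝ] E →L[ℝ] ℝ) → _) (h y) := by
      rw [← he]
      exact contDiffAt_map_inverse e
    exact (h1.comp y hh).clm_comp hΩ
  · have h1 : range ((↑) : (E ≃L[ℝ] (E →L[ℝ] ℝ)) → E →L[ℝ] E →L[ℝ] ℝ) ∈ 𝓝 (h y) := by
      rw [← he]
      exact ContinuousLinearEquiv.nhds e
    filter_upwards [hcont h1] with x hx u v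
    obtain ⟨e', he'⟩ := hx
    rw [← he', ContinuousLinearMap.comp_apply, ContinuousLinearMap.inverse_equiv]
    simp

set_option synthInstance.maxHeartbeats 200000 in
theorem hasFDerivAt_form_apply {b : E → F →L[ℝ] F →L[ℝ] ℝ} {b' : E →L[ℝ] F →L[ℝ] F →L[ℝ] ℝ}
    {f g : E → F} {f' g' : E →L[ℝ] F} {y : E} (hb : HasFDerivAt b b' y) (hf : HasFDerivAt f f' y)
    (hg : HasFDerivAt g g' y) :
    HasFDerivAt (fun x ↦ b x (f x) (g x))
      ((b'.flip (f y)).flip (g y) + (b y).flip (g y) ∘L f' + b y (f y) ∘L g') y := by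
  have h1 : HasFDerivAt (fun x ↦ b x (f x)) ((b y).comp f' + b'.flip (f y)) y := hb.clm_apply hf
  refine (h1.clm_apply hg).congr_fderiv ?_
  ext u
  simp
  ring

set_option synthInstance.maxHeartbeats 200000 in
/-- The exterior derivative of a 2-form commutes with pullbacks. -/
theorem twoFormDeriv_pullback {B : F → F →L[ℝ] F →L[ℝ] ℝ} {φ : E → F} {y : E}
    (hB : DifferentiableAt ℝ B (φ y)) (hφ : ContDiffAt ℝ 2 φ y)
    (hskew : ∀ u v, B (φ y) u v = -B (φ y) v u) (t u v : E) :
    twoFormDeriv (fun x u v ↦ B (φ x) (fderiv ℝ φ x u) (fderiv ℝ φ x v)) y t u v =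
      twoFormDeriv (fun q u v ↦ B q u v) (φ y) (fderiv ℝ φ y t) (fderiv ℝ φ y u)
        (fderiv ℝ φ y v) := by
  have hφ1 : HasFDerivAt φ (fderiv ℝ φ y) y :=
    (hφ.differentiableAt (by simp)).hasFDerivAt
  have hφ2 : HasFDerivAt (fderiv ℝ φ) (fderiv ℝ (fderiv ℝ φ) y) y :=
    ((hφ.fderiv_right (m := 1) (by norm_num)).differentiableAt (by simp)).hasFDerivAt
  have hsymm : ∀ v w, fderiv ℝ (fderiv ℝ φ) y v w = fderiv ℝ (fderiv ℝ φ) y w v :=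
    hφ.isSymmSndFDerivAt (by simp)
  have hBφ : HasFDerivAt (fun x ↦ B (φ x)) ((fderiv ℝ B (φ y)).comp (fderiv ℝ φ y)) y :=
    HasFDerivAt.comp (𝕜 := ℝ) (E := E) (F := F) (G := F →L[ℝ] F →L[ℝ] ℝ) (g := B) y
      hB.hasFDerivAt hφ1
  have h1 (a b c : E) : fderiv ℝ (fun x ↦ B (φ x) (fderiv ℝ φ x b) (fderiv ℝ φ x c)) y a =
      fderiv ℝ B (φ y) (fderiv ℝ φ y a) (fderiv ℝ φ y b) (fderiv ℝ φ y c) +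
      B (φ y) (fderiv ℝ (fderiv ℝ φ) y a b) (fderiv ℝ φ y c) +
      B (φ y) (fderiv ℝ φ y b) (fderiv ℝ (fderiv ℝ φ) y a c) := by
    have hb (w : E) : HasFDerivAt (fun x ↦ fderiv ℝ φ x w)
        ((fderiv ℝ (fderiv ℝ φ) y).flip w) y := by
      simpa using hφ2.clm_apply (hasFDerivAt_const w y)
    have e1 := hasFDerivAt_form_apply (hBφ) (hb b) (hb c)
    rw [e1.fderiv]
    simp [add_comm]
  have h2 (a b c : F) : fderiv ℝ (fun q ↦ B q b c) (φ y) a = fderiv ℝ B (φ y) a b c := by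
    have e1 := hasFDerivAt_form_apply hB.hasFDerivAt (hasFDerivAt_const b (φ y))
      (hasFDerivAt_const c (φ y))
    rw [e1.fderiv]
    simp
  simp only [twoFormDeriv, h1, h2]
  -- The terms with second derivatives of φ cancel in pairs: these derivatives are symmetric and B
  -- is skew.
  rw [hsymm v t, hsymm u t, hsymm v u, hskew (fderiv ℝ φ y u) (fderiv ℝ (fderiv ℝ φ) y t v),
    hskew (fderiv ℝ φ y v) (fderiv ℝ (fderiv ℝ φ) y t u),
    hskew (fderiv ℝ φ y t) (fderiv ℝ (fderiv ℝ φ) y u v)]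
  ring

/-- The version of `extDeriv_wedge_eq_zero_of_twoForm` in arbitrary degree. -/
theorem extDeriv_wedge_eq_zero_of_twoForm' {n : ℕ} {θ : Fin n → E → E →L[ℝ] ℝ} {y : E}
    {e : Fin n → E} (hθ : ∀ i, DifferentiableAt ℝ (θ i) y)
    (hd : ∀ i j, θ i y (e j) = if i = j then 1 else 0)
    {σ : Fin n → Fin n} (hσ : Function.Involutive σ) {ε : Fin n → ℝ}
    (hε : ∀ i, ε i ≠ 0) (hεσ : ∀ i, ε (σ i) = -ε i) {Ω : E → E → E → ℝ}
    (hΩ : ∀ᶠ x in 𝓝 y, ∀ u v, Ω x u v = ∑ i, ε i * (θ i x u * θ (σ i) x v))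
    (h1 : ∀ z z' x, (∀ i, θ i y z = 0) → (∀ i, θ i y z' = 0) → twoFormDeriv Ω y z z' x = 0)
    (h2 : ∀ z i, (∀ i, θ i y z = 0) → twoFormDeriv Ω y z (e i) (e (σ i)) = 0) :
    extDeriv (fun y ↦ wedge fun i ↦ θ i y) y = 0 := by
  obtain _ | m := n
  · have : (fun y ↦ wedge fun i ↦ θ i y) = fun _ : E ↦ wedge (V := E) (k := 0) fun i ↦ i.elim0 := by
      funext y
      congr 1
      ext i
      exact i.elim0
    rw [this]
    ext v
    simp [extDeriv, ContinuousAlternatingMap.alternatizeUncurryFin_apply]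
  · exact extDeriv_wedge_eq_zero_of_twoForm hθ hd hσ hε hεσ hΩ h1 h2

end Bilinear

/-! ### The local model in a vector space. -/

section Model

theorem linearIndependent_of_dual {V κ : Type*} [AddCommGroup V] [Module ℝ V] [Fintype κ]
    [DecidableEq κ] {e : κ → V} {θ : κ → V →ₗ[ℝ] ℝ} (h : ∀ i j, θ i (e j) = if i = j then 1 else 0) :
    LinearIndependent ℝ e := by
  rw [Fintype.linearIndependent_iff]
  intro c hc i
  have := congrArg (θ i) hc
  simpa [h] using this

theorem span_eq_of_dual {V κ : Type*} [AddCommGroup V] [Module ℝ V] [Fintype κ]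
    [DecidableEq κ] {D : Submodule ℝ V} [FiniteDimensional ℝ D] {e : κ → V} {θ : κ → V →ₗ[ℝ] ℝ}
    (h : ∀ i j, θ i (e j) = if i = j then 1 else 0) (he : ∀ i, e i ∈ D)
    (hD : Module.finrank ℝ D = Fintype.card κ) : Submodule.span ℝ (range e) = D := by
  refine Submodule.eq_of_le_of_finrank_eq (Submodule.span_le.2 ?_) ?_
  · rintro _ ⟨i, rfl⟩
    exact he i
  · rw [hD, finrank_span_eq_card (linearIndependent_of_dual h)]

/-- Multiplication by the first unit permutes the units up to sign: the permutation. -/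
def unitPerm : Fin 4 → Fin 4 := ![1, 0, 3, 2]

/-- Multiplication by the first unit permutes the units up to sign: the signs. -/
def unitSign : Fin 4 → ℝ := ![1, -1, 1, -1]

theorem unitPerm_involutive : Function.Involutive unitPerm := by
  intro a
  fin_cases a <;> rfl

theorem unitSign_mul_self (a : Fin 4) : unitSign a * unitSign a = 1 := by
  fin_cases a <;> simp [unitSign]

theorem unitSign_unitPerm (a : Fin 4) : unitSign (unitPerm a) = -unitSign a := by
  fin_cases a <;> simp [unitSign, unitPerm]

variable {E : Type*} [NormedAddCommGroup E] [NormedSpace ℝ E]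

/-- This is the source of σ and ε: left multiplication by J₀ exchanges 1 with J₀ and J₁ with J₂, up
to sign. -/
theorem QuaternionHermitianOn.unit_zero_units {h : E →L[ℝ] E →L[ℝ] ℝ} {A : Fin 3 → E →L[ℝ] E}
    {D : Submodule ℝ E} (H : QuaternionHermitianOn h A D) {u : E} (hu : u ∈ D) (a : Fin 4) :
    A 0 (unitsWithOne A a u) = unitSign a • unitsWithOne A (unitPerm a) u := by
  fin_cases a
  · exact (one_smul ℝ (A 0 u)).symm
  · exact (H.sq 0 u hu).trans (neg_one_smul ℝ u).symm
  · exact (H.mul u hu).trans (one_smul ℝ (A 2 u)).symm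
  · have h1 : A 0 (A 2 u) = (-1 : ℝ) • A 1 u := by
      rw [← H.mul u hu, H.sq _ _ (H.mem _ _ hu), neg_one_smul]
    exact h1

/-- The local model of the main theorem: an adapted frame whose dual coframe has closed wedge
product. -/
theorem exists_frame_closed [FiniteDimensional ℝ E] {y₀ : E} {h : E → E →L[ℝ] E →L[ℝ] ℝ}
    {A : Fin 3 → E → E →L[ℝ] E} {D : E → Submodule ℝ E} (hh : ContDiffAt ℝ ∞ h y₀)
    (hA : ∀ a, ContDiffAt ℝ ∞ (A a) y₀)
    (H : ∀ᶠ y in 𝓝 y₀, QuaternionHermitianOn (h y) (fun a ↦ A a y) (D y)) {p : ℕ}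
    {X : Fin (4 * p) → E → E} (hX : ∀ i, ContDiffAt ℝ ∞ (X i) y₀)
    (hXD : ∀ᶠ y in 𝓝 y₀, LinearIndependent ℝ (fun i ↦ X i y) ∧
      D y = Submodule.span ℝ (range fun i ↦ X i y)) {Ω : E → E → E → ℝ}
    (hΩ : ∀ᶠ y in 𝓝 y₀, ∀ u v, Ω y u v = h y (A 0 y u) v)
    (hreal : ∀ᶠ y in 𝓝 y₀, ∀ z, (∀ d ∈ D y, h y d z = 0) → ∀ v, Ω y z v = 0)
    (h1 : ∀ z z' x, (∀ d ∈ D y₀, h y₀ d z = 0) → (∀ d ∈ D y₀, h y₀ d z' = 0) →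
      twoFormDeriv Ω y₀ z z' x = 0)
    (h2 : ∀ z d, (∀ d ∈ D y₀, h y₀ d z = 0) → d ∈ D y₀ → ∀ c : ℝ,
      twoFormDeriv Ω y₀ z d (c • A 0 y₀ d) = 0) :
    ∃ e : Fin (4 * p) → E → E, (∀ i, ContDiffAt ℝ ∞ (e i) y₀) ∧
      (∀ᶠ y in 𝓝 y₀, (∀ i, e i y ∈ D y) ∧
        (∀ i j, h y (e i y) (e j y) = if i = j then 1 else 0) ∧
        ∀ (a : Fin 3) (j : Fin p),
          e (finProdFinEquiv (a.succ, j)) y = A a y (e (finProdFinEquiv (0, j)) y)) ∧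
      extDeriv (fun y ↦ wedge fun i ↦ h y (e i y)) y₀ = 0 := by
  obtain ⟨u, hu, hu'⟩ := exists_adapted_frame hh hA H hX hXD le_rfl
  let e : Fin (4 * p) → E → E := fun i y ↦
    unitsWithOne (fun a ↦ A a y) (finProdFinEquiv.symm i).1 (u (finProdFinEquiv.symm i).2 y)
  have he (i) : ContDiffAt ℝ ∞ (e i) y₀ := contDiffAt_unitsWithOne hA (hu _) _
  have heD : ∀ᶠ y in 𝓝 y₀, ∀ i, e i y ∈ D y := by
    filter_upwards [hu', H] with y hy Hy i using Hy.units_mem _ (hy.1 _)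
  have heo : ∀ᶠ y in 𝓝 y₀, ∀ i j, h y (e i y) (e j y) = if i = j then 1 else 0 := by
    filter_upwards [hu'] with y hy i j
    rw [hy.2]
    simp only [EmbeddingLike.apply_eq_iff_eq]
  refine ⟨e, he, ?_, ?_⟩
  · filter_upwards [heD, heo] with y hy hy'
    refine ⟨hy, hy', fun a j ↦ ?_⟩
    simp only [e, Equiv.symm_apply_apply, unitsWithOne_succ, unitsWithOne_zero]
  have hspan : ∀ᶠ y in 𝓝 y₀, Submodule.span ℝ (range fun i ↦ e i y) = D y := by
    filter_upwards [heD, heo, hXD] with y hy hy' hXy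
    refine span_eq_of_dual (θ := fun i ↦ (h y (e i y) : E →ₗ[ℝ] ℝ)) hy' hy ?_
    rw [hXy.2, finrank_span_eq_card hXy.1]
  have hker : ∀ᶠ y in 𝓝 y₀, ∀ z, (∀ i, h y (e i y) z = 0) → ∀ d ∈ D y, h y d z = 0 := by
    filter_upwards [hspan] with y hy z hz d hd
    rw [← hy] at hd
    induction hd using Submodule.span_induction with
    | mem x hx => obtain ⟨i, rfl⟩ := hx; exact hz i
    | zero => simp
    | add a b _ _ ha hb => simp [ha, hb]
    | smul c a _ ha => simp [ha]
  let σ : Fin (4 * p) → Fin (4 * p) := fun i ↦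
    finProdFinEquiv (unitPerm (finProdFinEquiv.symm i).1, (finProdFinEquiv.symm i).2)
  let ε : Fin (4 * p) → ℝ := fun i ↦ unitSign (finProdFinEquiv.symm i).1
  have hAe : ∀ᶠ y in 𝓝 y₀, ∀ i, A 0 y (e i y) = ε i • e (σ i) y := by
    filter_upwards [hu', H] with y hy Hy i
    simp only [e, ε, σ, Equiv.symm_apply_apply]
    exact Hy.unit_zero_units (hy.1 _) _
  have hε (i) : ε i * ε i = 1 := unitSign_mul_self _
  refine extDeriv_wedge_eq_zero_of_twoForm' (e := fun i ↦ e i y₀) (σ := σ) (ε := ε) (Ω := Ω)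
    (fun i ↦ (hh.clm_apply (he i)).differentiableAt (by simp)) heo.self_of_nhds (fun i ↦ ?_)
    (fun i ↦ ?_) (fun i ↦ ?_) ?_ (fun z z' x hz hz' ↦ ?_) fun z i hz ↦ ?_
  · simp only [σ, Equiv.symm_apply_apply, unitPerm_involutive _, Prod.mk.eta, Equiv.apply_symm_apply]
  · intro h0
    simpa [h0] using hε i
  · simp only [ε, σ, Equiv.symm_apply_apply, unitSign_unitPerm]
  · filter_upwards [heo, hker, hAe, hΩ, hreal] with y ho hk hAy hΩy hr v w
    -- The vector v minus its projection to D is orthogonal to D, hence in the kernel of Ω, so only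
    -- A₀ on the frame enters.
    have h3 : Ω y (v - ∑ i, h y (e i y) v • e i y) w = 0 := by
      refine hr _ (hk _ fun i ↦ ?_) w
      simp [ho]
    rw [hΩy] at h3 ⊢
    simp only [map_sub, map_sum, map_smul, sub_apply, sum_apply, smul_apply, sub_eq_zero, hAy] at h3
    rw [h3]
    refine Finset.sum_congr rfl fun i _ ↦ ?_
    simp only [smul_eq_mul]
    ring
  · exact h1 z z' x (hker.self_of_nhds z hz) (hker.self_of_nhds z' hz')
  -- Since εᵢ² = 1, the relation A₀eᵢ = εᵢ e_{σi} can be solved for e_{σi}; the scalar c in `h2`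
  -- accommodates εᵢ.
  · have h3 : e (σ i) y₀ = ε i • A 0 y₀ (e i y₀) := by
      rw [hAe.self_of_nhds, smul_smul, hε, one_smul]
    rw [h3]
    exact h2 z _ (hker.self_of_nhds z hz) (heD.self_of_nhds i) _

end Model

/-! ### Pullback of forms by the immersion, in charts. -/

section Immersion

variable {F : Type*} [NormedAddCommGroup F] [NormedSpace ℝ F]
variable {N : Type*} [TopologicalSpace N] [ChartedSpace F N] [IsManifold 𝓘(ℝ, F) ∞ N]
variable {E : Type*} [NormedAddCommGroup E] [NormedSpace ℝ E]
variable {M : Type*} [TopologicalSpace M] [ChartedSpace E M] [IsManifold 𝓘(ℝ, E) ∞ M]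

/-- The differential of `ι` at `x`, on vectors given by their coordinates in the chart at `x₀`. -/
def chartPush (F : Type*) [NormedAddCommGroup F] [NormedSpace ℝ F]
    {N : Type*} [TopologicalSpace N] [ChartedSpace F N] (ι : M → N) (x₀ x : M) :
    E →L[ℝ] T F (ι x) :=
  (push F ι x).comp (fromChart x₀ x)

omit [IsManifold 𝓘(ℝ, F) ∞ N] in
theorem chartPush_apply (ι : M → N) (x₀ x : M) (u : E) :
    chartPush F ι x₀ x u = push F ι x (fromChart x₀ x u) := rfl

/-- The expression of `ι` in the chart at `x₀` and a chart of `N`. -/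
def inCharts (F : Type*) [NormedAddCommGroup F] [NormedSpace ℝ F]
    {N : Type*} [TopologicalSpace N] [ChartedSpace F N] (ι : M → N) (x₀ : M) (q₀ : N) (y : E) : F :=
  extChartAt 𝓘(ℝ, F) q₀ (ι ((extChartAt 𝓘(ℝ, E) x₀).symm y))

variable {ι : M → N}

omit [IsManifold 𝓘(ℝ, F) ∞ N] [IsManifold 𝓘(ℝ, E) ∞ M] in
theorem mem_source_of_mem_target {x₀ : M} {y : E} (hy : y ∈ (extChartAt 𝓘(ℝ, E) x₀).target) :
    (extChartAt 𝓘(ℝ, E) x₀).symm y ∈ (chartAt E x₀).source := by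
  simpa using (extChartAt 𝓘(ℝ, E) x₀).map_target hy

theorem contDiffAt_inCharts (hι : ContMDiff 𝓘(ℝ, E) 𝓘(ℝ, F) ∞ ι) {x₀ : M} {y : E}
    (hy : y ∈ (extChartAt 𝓘(ℝ, E) x₀).target) {q₀ : N}
    (hq : ι ((extChartAt 𝓘(ℝ, E) x₀).symm y) ∈ (chartAt F q₀).source) :
    ContDiffAt ℝ ∞ (inCharts F ι x₀ q₀) y := by
  have h1 : ContMDiffAt 𝓘(ℝ, E) 𝓘(ℝ, F) ∞ (fun x ↦ extChartAt 𝓘(ℝ, F) q₀ (ι x))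
      ((extChartAt 𝓘(ℝ, E) x₀).symm y) :=
    (contMDiffAt_extChartAt' hq).comp _ hι.contMDiffAt
  have h2 := ContMDiffAt.contDiffAt_comp_extChartAt_symm (mem_source_of_mem_target hy) h1
  rwa [(extChartAt 𝓘(ℝ, E) x₀).right_inv hy] at h2

theorem fromChart_fderiv_inCharts (hι : ContMDiff 𝓘(ℝ, E) 𝓘(ℝ, F) ∞ ι) {x₀ : M} {y : E}
    (hy : y ∈ (extChartAt 𝓘(ℝ, E) x₀).target) {q₀ : N}
    (hq : ι ((extChartAt 𝓘(ℝ, E) x₀).symm y) ∈ (chartAt F q₀).source) (u : E) :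
    fromChart (F := F) q₀ (ι ((extChartAt 𝓘(ℝ, E) x₀).symm y))
      (fderiv ℝ (inCharts F ι x₀ q₀) y u) = chartPush F ι x₀ _ u := by
  have h1 : MDifferentiableAt 𝓘(ℝ, E) 𝓘(ℝ, E) (extChartAt 𝓘(ℝ, E) x₀).symm y :=
    ((contMDiffOn_extChartAt_symm x₀).contMDiffAt
      ((isOpen_extChartAt_target x₀).mem_nhds hy)).mdifferentiableAt (n := ∞) (by simp)
  have h2 : MDifferentiableAt 𝓘(ℝ, E) 𝓘(ℝ, F) ι ((extChartAt 𝓘(ℝ, E) x₀).symm y) :=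
    hι.contMDiffAt.mdifferentiableAt (by simp)
  have h3 : MDifferentiableAt 𝓘(ℝ, F) 𝓘(ℝ, F) (extChartAt 𝓘(ℝ, F) q₀)
      (ι ((extChartAt 𝓘(ℝ, E) x₀).symm y)) :=
    (contMDiffAt_extChartAt' (n := ∞) hq).mdifferentiableAt (by simp)
  have h4 := mfderiv_comp y h3 (h2.comp y h1)
  have h5 := mfderiv_comp y h2 h1
  have h6 : fderiv ℝ (inCharts F ι x₀ q₀) y u =
      toChart q₀ (ι ((extChartAt 𝓘(ℝ, E) x₀).symm y)) (chartPush F ι x₀ _ u) := by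
    rw [toChart_eq_mfderiv hq, chartPush_apply, fromChart_eq_mfderiv hy, ← mfderiv_eq_fderiv]
    exact (congrArg (fun L : E →L[ℝ] F ↦ L u) h4).trans
      (congrArg (fun L : E →L[ℝ] T F (ι ((extChartAt 𝓘(ℝ, E) x₀).symm y)) ↦
        mfderiv 𝓘(ℝ, F) 𝓘(ℝ, F) (extChartAt 𝓘(ℝ, F) q₀) (ι ((extChartAt 𝓘(ℝ, E) x₀).symm y)) (L u)) h5)
  rw [h6, fromChart_toChart hq]

/-- A field of bilinear forms on `N`, in the chart at `q₀`. -/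
def formInChart (b : ∀ x : N, T F x →L[ℝ] T F x →L[ℝ] ℝ) (q₀ : N) (q : F) : F →L[ℝ] F →L[ℝ] ℝ :=
  pullForm (b ((extChartAt 𝓘(ℝ, F) q₀).symm q)) (fromChart q₀ _)

theorem contDiffAt_formInChart [FiniteDimensional ℝ F] {b : ∀ x : N, T F x →L[ℝ] T F x →L[ℝ] ℝ}
    {q₀ : N} (hb : ∀ u v : F, ContMDiffAt 𝓘(ℝ, F) 𝓘(ℝ, ℝ) ∞
      (fun x ↦ b x (fromChart q₀ x u) (fromChart q₀ x v)) q₀) :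
    ContDiffAt ℝ ∞ (formInChart b q₀) (extChartAt 𝓘(ℝ, F) q₀ q₀) :=
  contDiffAt_form_of_apply fun u v ↦
    ContMDiffAt.contDiffAt_comp_extChartAt_symm (mem_chart_source F q₀) (hb u v)

/-- In charts the differential of ι is an ordinary derivative; this reduces smoothness and exterior
derivatives of pullbacks to calculus between normed spaces. -/
theorem eventually_pullForm_chartPush (hι : ContMDiff 𝓘(ℝ, E) 𝓘(ℝ, F) ∞ ι) {x₀ : M} {y₀ : E}
    (hy₀ : y₀ ∈ (extChartAt 𝓘(ℝ, E) x₀).target) (b : ∀ x : N, T F x →L[ℝ] T F x →L[ℝ] ℝ) {q₀ : N}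
    (hq : ι ((extChartAt 𝓘(ℝ, E) x₀).symm y₀) ∈ (chartAt F q₀).source) :
    ∀ᶠ y in 𝓝 y₀, pullForm (b (ι ((extChartAt 𝓘(ℝ, E) x₀).symm y))) (chartPush F ι x₀ _) =
      pullForm (formInChart b q₀ (inCharts F ι x₀ q₀ y)) (fderiv ℝ (inCharts F ι x₀ q₀) y) := by
  have h1 : ∀ᶠ y in 𝓝 y₀, ι ((extChartAt 𝓘(ℝ, E) x₀).symm y) ∈ (chartAt F q₀).source := by
    have h2 := eventually_comp_extChartAt_symm (mem_source_of_mem_target hy₀)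
      (hι.continuous.continuousAt.preimage_mem_nhds ((chartAt F q₀).open_source.mem_nhds hq))
    rwa [(extChartAt 𝓘(ℝ, E) x₀).right_inv hy₀] at h2
  filter_upwards [h1, (isOpen_extChartAt_target x₀).mem_nhds hy₀] with y hy hyt
  ext u v
  rw [pullForm_apply, pullForm_apply, ← fromChart_fderiv_inCharts hι hyt hy,
    ← fromChart_fderiv_inCharts hι hyt hy, formInChart, pullForm_apply, inCharts,
    (extChartAt 𝓘(ℝ, F) q₀).left_inv (by simpa using hy)]

set_option synthInstance.maxHeartbeats 200000 in
theorem contDiffAt_pullForm_chartPush [FiniteDimensional ℝ F] [FiniteDimensional ℝ E]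
    (hι : ContMDiff 𝓘(ℝ, E) 𝓘(ℝ, F) ∞ ι) {x₀ : M} {y₀ : E}
    (hy₀ : y₀ ∈ (extChartAt 𝓘(ℝ, E) x₀).target) {b : ∀ x : N, T F x →L[ℝ] T F x →L[ℝ] ℝ} {q₀ : N}
    (hq : ι ((extChartAt 𝓘(ℝ, E) x₀).symm y₀) = q₀)
    (hb : ∀ u v : F, ContMDiffAt 𝓘(ℝ, F) 𝓘(ℝ, ℝ) ∞
      (fun x ↦ b x (fromChart q₀ x u) (fromChart q₀ x v)) q₀) :
    ContDiffAt ℝ ∞ (fun y ↦ pullForm (b (ι ((extChartAt 𝓘(ℝ, E) x₀).symm y)))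
      (chartPush (E := E) F ι x₀ _)) y₀ := by
  have hq' : ι ((extChartAt 𝓘(ℝ, E) x₀).symm y₀) ∈ (chartAt F q₀).source := by
    rw [hq]
    exact mem_chart_source F q₀
  refine ContDiffAt.congr_of_eventuallyEq ?_ (eventually_pullForm_chartPush hι hy₀ b hq')
  have h1 := contDiffAt_inCharts hι hy₀ hq'
  have h2 : ContDiffAt ℝ ∞ (fun y ↦ formInChart b q₀ (inCharts F ι x₀ q₀ y)) y₀ := by
    refine ContDiffAt.comp (F := F) (G := F →L[ℝ] F →L[ℝ] ℝ) (g := formInChart b q₀) y₀ ?_ h1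
    rw [inCharts, hq]
    exact contDiffAt_formInChart hb
  have h3 : ContDiffAt ℝ ∞ (fderiv ℝ (inCharts F ι x₀ q₀)) y₀ := h1.fderiv_right (by simp)
  exact contDiffAt_form_of_apply fun u v ↦
    (h2.clm_apply (h3.clm_apply contDiffAt_const)).clm_apply (h3.clm_apply contDiffAt_const)

/-- The chart of N is the one at the image point, where the derivative of the Kähler form is known;
on M the point may lie anywhere in the chart at `x₀`. -/
theorem twoFormDeriv_pullForm_chartPush [FiniteDimensional ℝ F]
    (hι : ContMDiff 𝓘(ℝ, E) 𝓘(ℝ, F) ∞ ι) {x₀ : M} {y₀ : E}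
    (hy₀ : y₀ ∈ (extChartAt 𝓘(ℝ, E) x₀).target) {b : ∀ x : N, T F x →L[ℝ] T F x →L[ℝ] ℝ} {q₀ : N}
    (hq : ι ((extChartAt 𝓘(ℝ, E) x₀).symm y₀) = q₀)
    (hb : ∀ u v : F, ContMDiffAt 𝓘(ℝ, F) 𝓘(ℝ, ℝ) ∞
      (fun x ↦ b x (fromChart q₀ x u) (fromChart q₀ x v)) q₀)
    (hskew : ∀ u v, b q₀ u v = -b q₀ v u) (t u v : E) :
    twoFormDeriv (fun y u v ↦ b (ι ((extChartAt 𝓘(ℝ, E) x₀).symm y)) (chartPush F ι x₀ _ u)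
        (chartPush F ι x₀ _ v)) y₀ t u v =
      twoFormDeriv (fun q u v ↦ formInChart b q₀ q u v) (extChartAt 𝓘(ℝ, F) q₀ q₀)
        (fderiv ℝ (inCharts F ι x₀ q₀) y₀ t) (fderiv ℝ (inCharts F ι x₀ q₀) y₀ u)
        (fderiv ℝ (inCharts F ι x₀ q₀) y₀ v) := by
  have hq' : ι ((extChartAt 𝓘(ℝ, E) x₀).symm y₀) ∈ (chartAt F q₀).source := by
    rw [hq]
    exact mem_chart_source F q₀
  have h0 : inCharts F ι x₀ q₀ y₀ = extChartAt 𝓘(ℝ, F) q₀ q₀ := by rw [inCharts, hq]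
  have h1 := contDiffAt_inCharts hι hy₀ hq'
  have h2 : DifferentiableAt ℝ (formInChart b q₀) (inCharts F ι x₀ q₀ y₀) := by
    rw [h0]
    exact (contDiffAt_formInChart hb).differentiableAt (by simp)
  have h3 : ∀ u v, formInChart b q₀ (inCharts F ι x₀ q₀ y₀) u v =
      -formInChart b q₀ (inCharts F ι x₀ q₀ y₀) v u := by
    intro u v
    rw [h0, formInChart, extChartAt_to_inv]
    exact hskew _ _
  have h4 := twoFormDeriv_pullback h2 (h1.of_le (by norm_cast)) h3 t u v
  rw [h0] at h4
  rw [← h4]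
  have h5 (u v : E) : (fun y ↦ b (ι ((extChartAt 𝓘(ℝ, E) x₀).symm y)) (chartPush F ι x₀ _ u)
      (chartPush F ι x₀ _ v)) =ᶠ[𝓝 y₀] fun y ↦ formInChart b q₀ (inCharts F ι x₀ q₀ y)
        (fderiv ℝ (inCharts F ι x₀ q₀) y u) (fderiv ℝ (inCharts F ι x₀ q₀) y v) := by
    filter_upwards [eventually_pullForm_chartPush hι hy₀ b hq'] with y hy
    exact congrArg (fun L : E →L[ℝ] E →L[ℝ] ℝ ↦ L u v) hy
  simp only [twoFormDeriv, (h5 _ _).fderiv_eq]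

end Immersion

/-! ### The exterior derivative of a local Kähler form. -/

section Submanifold

variable {F : Type*} [NormedAddCommGroup F] [NormedSpace ℝ F]
variable {N : Type*} [TopologicalSpace N] [ChartedSpace F N] [IsManifold 𝓘(ℝ, F) ∞ N]
variable {E : Type*} [NormedAddCommGroup E] [NormedSpace ℝ E]
variable {M : Type*} [TopologicalSpace M] [ChartedSpace E M] [IsManifold 𝓘(ℝ, E) ∞ M]

/-- Orthogonality of a basis of H does not pass to linear combinations, but skewness does. -/
theorem QuaternionHermitian.inner_skew (S : QuaternionHermitian F N) {x : N} {K : EndT F x}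
    (hK : K ∈ S.H x) (v w : T F x) : S.g.inner x (K v) w = -S.g.inner x v (K w) := by
  obtain ⟨U, -, hx, J, -, hJ⟩ := S.localBasis x
  obtain ⟨h1, h2, h3⟩ := hJ x hx
  rw [h2] at hK
  induction hK using Submodule.span_induction with
  | mem K hK =>
    obtain ⟨a, rfl⟩ := hK
    simp only
    rw [← h3 a v (J a x w), h1.sq a w, map_neg, neg_neg]
  | zero => simp
  | add K L _ _ hK hL =>
    simp only [add_apply, map_add, hK, hL]
    ring
  | smul c K _ hK => simp only [smul_apply, map_smul, hK, smul_neg]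

/-- The exterior derivative of the Kähler form of a local almost complex structure `J 0` in `H`, in
terms of the Lee form and of the first-order data of `LCQK.exists_first_order`. -/
theorem LCQK.exists_twoFormDeriv (S : LCQK F N) (x₀ : N) :
    ∃ J : Fin 3 → ∀ x : N, EndT F x,
      (∀ a, ContMDiffAt 𝓘(ℝ, F) (𝓘(ℝ, F).prod 𝓘(ℝ, F →L[ℝ] F)) ∞
        (fun x ↦ TotalSpace.mk' (F →L[ℝ] F) (E := fun y : N ↦ EndT F y) x (J a x)) x₀) ∧
      (∀ᶠ x in 𝓝 x₀, IsQuaternionTriple (fun a ↦ J a x) ∧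
        S.H x = Submodule.span ℝ (range fun a ↦ J a x) ∧
        ∀ a v w, S.g.inner x (J a x v) (J a x w) = S.g.inner x v w) ∧
      ∃ K : F → EndT F x₀, (∀ t, K t ∈ S.H x₀) ∧
        (∀ t w, S.g.inner x₀ (K t w) (J 0 x₀ w) = 0) ∧
        ∀ t u v : F, twoFormDeriv
            (fun q u v ↦ formInChart (fun x ↦ (S.g.inner x).comp (J 0 x)) x₀ q u v)
            (extChartAt 𝓘(ℝ, F) x₀ x₀) t u v =
          S.leeForm x₀ (fromChart x₀ x₀ t) *
              S.g.inner x₀ (J 0 x₀ (fromChart x₀ x₀ u)) (fromChart x₀ x₀ v) +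
            S.leeForm x₀ (fromChart x₀ x₀ u) *
              S.g.inner x₀ (J 0 x₀ (fromChart x₀ x₀ v)) (fromChart x₀ x₀ t) +
            S.leeForm x₀ (fromChart x₀ x₀ v) *
              S.g.inner x₀ (J 0 x₀ (fromChart x₀ x₀ t)) (fromChart x₀ x₀ u) +
            S.g.inner x₀ (K t (fromChart x₀ x₀ u)) (fromChart x₀ x₀ v) +
            S.g.inner x₀ (K u (fromChart x₀ x₀ v)) (fromChart x₀ x₀ t) +
            S.g.inner x₀ (K v (fromChart x₀ x₀ t)) (fromChart x₀ x₀ u) := by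
  obtain ⟨J, hJs, hJ, Γ, K, hΓ, hK, hK', hd⟩ := S.exists_first_order x₀
  refine ⟨J, hJs, hJ, K, hK, hK', fun t u v ↦ ?_⟩
  have h1 (t u v : F) : fderiv ℝ (fun q ↦ formInChart (fun x ↦ (S.g.inner x).comp (J 0 x)) x₀ q u v)
      (extChartAt 𝓘(ℝ, F) x₀ x₀) t = _ := hd t u v
  rw [twoFormDeriv, h1, h1, h1]
  -- Symmetry of Γ makes the six connection terms of the cyclic sum cancel in pairs.
  rw [hΓ u t, hΓ v t, hΓ v u,
    S.g.symm x₀ (J 0 x₀ (fromChart x₀ x₀ u)) (Γ t v), S.g.symm x₀ (J 0 x₀ (fromChart x₀ x₀ v)) (Γ t u),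
    S.g.symm x₀ (J 0 x₀ (fromChart x₀ x₀ t)) (Γ u v)]
  ring

end Submanifold

/-! ### The CR-structure in a chart, and closed local frames. -/

section Submanifold

variable {F : Type*} [NormedAddCommGroup F] [NormedSpace ℝ F]
variable {N : Type*} [TopologicalSpace N] [ChartedSpace F N] [IsManifold 𝓘(ℝ, F) ∞ N]
variable {E : Type*} [NormedAddCommGroup E] [NormedSpace ℝ E]
variable {M : Type*} [TopologicalSpace M] [ChartedSpace E M] [IsManifold 𝓘(ℝ, E) ∞ M]

/-- A distribution in the chart at `x₀`. -/
def distInChart (D : ∀ x : M, Submodule ℝ (T E x)) (x₀ x : M) : Submodule ℝ E :=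
  (D x).comap (fromChart (F := E) x₀ x : E →ₗ[ℝ] T E x)

theorem mem_distInChart {D : ∀ x : M, Submodule ℝ (T E x)} {x₀ x : M} {u : E} :
    u ∈ distInChart D x₀ x ↔ fromChart x₀ x u ∈ D x := Iff.rfl

omit [IsManifold 𝓘(ℝ, F) ∞ N] in
theorem chartPush_injective {ι : M → N} {x₀ x : M} (hx : x ∈ (chartAt E x₀).source)
    (hinj : Function.Injective (push F ι x : T E x → T F (ι x))) :
    Function.Injective (chartPush (E := E) F ι x₀ x) := by
  intro u v huv
  have h1 : fromChart x₀ x u = fromChart x₀ x v := hinj huv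
  rw [← toChart_fromChart hx u, h1, toChart_fromChart hx]

theorem fromChart_mem_perp {S : QuaternionHermitian F N} {ι : M → N}
    {D : ∀ x : M, Submodule ℝ (T E x)} {x₀ x : M} (hx : x ∈ (chartAt E x₀).source) {z : E}
    (hz : ∀ d ∈ distInChart D x₀ x, pullForm (S.g.inner (ι x)) (chartPush F ι x₀ x) d z = 0) :
    fromChart x₀ x z ∈ perp S ι D x := by
  intro X hX
  have h1 := hz (toChart x₀ x X) (by rwa [mem_distInChart, fromChart_toChart hx])
  rwa [pullForm_apply, chartPush_apply, chartPush_apply, fromChart_toChart hx] at h1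

/-- The hypothesis on A says that `A a` is the tangential part of `J a`. On D the image under `J a`
is already tangent, so `A a` agrees with `J a` there and inherits its relations; none is claimed off
D. -/
theorem quaternionHermitianOn_chart {S : QuaternionHermitian F N} {ι : M → N}
    {D : ∀ x : M, Submodule ℝ (T E x)} {p : ℕ} (hM : IsQuaternionCRSubmanifold S ι D p) {x₀ x : M}
    (hx : x ∈ (chartAt E x₀).source) {J : Fin 3 → EndT F (ι x)} (hJ : IsQuaternionTriple J)
    (hJH : ∀ a, J a ∈ S.H (ι x))
    (hJo : ∀ a v w, S.g.inner (ι x) (J a v) (J a w) = S.g.inner (ι x) v w) {A : Fin 3 → E →L[ℝ] E}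
    (hA : ∀ a u v, pullForm (S.g.inner (ι x)) (chartPush F ι x₀ x) (A a u) v =
      pullForm ((S.g.inner (ι x)).comp (J a)) (chartPush F ι x₀ x) u v) :
    QuaternionHermitianOn (pullForm (S.g.inner (ι x)) (chartPush F ι x₀ x)) A
        (distInChart D x₀ x) ∧
      ∀ a, ∀ u ∈ distInChart D x₀ x, chartPush F ι x₀ x (A a u) = J a (chartPush F ι x₀ x u) := by
  have hinj := chartPush_injective (F := F) hx (hM.immersion x)
  have hpos (u : E) (hu : u ≠ 0) :
      0 < pullForm (S.g.inner (ι x)) (chartPush F ι x₀ x) u u :=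
    S.g.pos _ _ fun h0 ↦ hu (hinj (h0.trans (map_zero _).symm))
  have key (a : Fin 3) (u : E) (hu : u ∈ distInChart D x₀ x) :
      A a u ∈ distInChart D x₀ x ∧ chartPush F ι x₀ x (A a u) = J a (chartPush F ι x₀ x u) := by
    obtain ⟨X', hX', h1⟩ := hM.invariant x (J a) (hJH a) _ hu
    -- Both sides represent the same linear form for a positive definite product, so their
    -- difference has length zero.
    have h2 : A a u = toChart x₀ x X' := by
      by_contra hne
      refine (hpos _ (sub_ne_zero.2 hne)).ne' ?_
      rw [ContinuousLinearMap.map_sub₂, hA, pullForm_apply, pullForm_apply, chartPush_apply ι x₀ x (toChart _ _ _),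
        fromChart_toChart hx, h1]
      exact sub_self _
    rw [h2, mem_distInChart, chartPush_apply, fromChart_toChart hx]
    exact ⟨hX', h1⟩
  refine ⟨⟨fun u v ↦ S.g.symm _ _ _, hpos, fun a u hu ↦ (key a u hu).1, fun a u hu ↦ hinj ?_,
    fun u hu ↦ hinj ?_, fun u hu ↦ hinj ?_, fun a u v hu hv ↦ ?_⟩, fun a u hu ↦ (key a u hu).2⟩
  · rw [(key _ _ (key _ _ hu).1).2, (key _ _ hu).2, hJ.sq, map_neg]
  · rw [(key _ _ (key _ _ hu).1).2, (key _ _ hu).2, (key _ _ hu).2, hJ.mul]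
  · rw [(key _ _ (key _ _ hu).1).2, (key _ _ hu).2, map_neg, (key _ _ hu).2, hJ.anticomm]
  · rw [pullForm_apply, (key _ _ hu).2, (key _ _ hv).2, hJo, pullForm_apply]

theorem distInChart_eq_span {D : ∀ x : M, Submodule ℝ (T E x)} {r : ℕ} {x₀ x : M}
    (hx : x ∈ (chartAt E x₀).source) {X : Fin r → T E x} (hX : LinearIndependent ℝ X)
    (hD : D x = Submodule.span ℝ (range X)) :
    LinearIndependent ℝ (fun i ↦ toChart x₀ x (X i)) ∧
      distInChart D x₀ x = Submodule.span ℝ (range fun i ↦ toChart x₀ x (X i)) := by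
  let L : T E x →ₗ[ℝ] E := (toChart (F := E) x₀ x : T E x →ₗ[ℝ] E)
  have hL : Function.Injective L := Function.LeftInverse.injective (fromChart_toChart hx)
  refine ⟨hX.map' L (LinearMap.ker_eq_bot.2 hL), ?_⟩
  have h1 : (range fun i ↦ toChart x₀ x (X i)) = L '' range X := by
    rw [← range_comp]
    rfl
  rw [h1, Submodule.span_image, ← hD]
  ext u
  constructor
  · intro hu
    exact ⟨_, hu, toChart_fromChart hx u⟩
  · rintro ⟨v, hv, rfl⟩
    have h2 : fromChart x₀ x (L v) = v := fromChart_toChart hx v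
    rw [mem_distInChart, h2]
    exact hv

theorem IsDistribution.exists_frame_inChart {D : ∀ x : M, Submodule ℝ (T E x)} {r : ℕ}
    (hD : IsDistribution D r) {x₀ : M} {y₀ : E} (hy₀ : y₀ ∈ (extChartAt 𝓘(ℝ, E) x₀).target) :
    ∃ X : Fin r → E → E, (∀ i, ContDiffAt ℝ ∞ (X i) y₀) ∧ ∀ᶠ y in 𝓝 y₀,
      LinearIndependent ℝ (fun i ↦ X i y) ∧
      distInChart D x₀ ((extChartAt 𝓘(ℝ, E) x₀).symm y) = Submodule.span ℝ (range fun i ↦ X i y) := by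
  obtain ⟨U, hU, hx, X, hX, hXD⟩ := hD ((extChartAt 𝓘(ℝ, E) x₀).symm y₀)
  have hs := mem_source_of_mem_target hy₀
  have hr := (extChartAt 𝓘(ℝ, E) x₀).right_inv hy₀
  refine ⟨fun i y ↦ toChart x₀ _ (X i ((extChartAt 𝓘(ℝ, E) x₀).symm y)), fun i ↦ ?_, ?_⟩
  · have h1 := ContMDiffAt.contDiffAt_comp_extChartAt_symm hs
      ((contMDiffAt_field_iff hs).1 ((hX i).contMDiffAt (hU.mem_nhds hx)))
    rwa [hr] at h1
  · have h1 := eventually_comp_extChartAt_symm hs (hU.mem_nhds hx)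
    rw [hr] at h1
    filter_upwards [h1, (isOpen_extChartAt_target x₀).mem_nhds hy₀] with y hy hyt
    have hys := mem_source_of_mem_target hyt
    exact distInChart_eq_span hys (hXD _ hy).1 (hXD _ hy).2

/-- Around each point of a chart there is a smooth adapted frame whose dual coframe has closed wedge
product. -/
theorem exists_local_frame [FiniteDimensional ℝ F] [FiniteDimensional ℝ E] (S : LCQK F N)
    {ι : M → N} {D : ∀ x : M, Submodule ℝ (T E x)} {p : ℕ}
    (hM : IsQuaternionCRSubmanifold S.toQuaternionHermitian ι D p)
    (hB : ∀ x : M, ∀ Z ∈ perp S.toQuaternionHermitian ι D x, S.leeForm (ι x) (push F ι x Z) = 0)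
    {x₀ : M} {y₀ : E} (hy₀ : y₀ ∈ (extChartAt 𝓘(ℝ, E) x₀).target) :
    ∃ (e : Fin (4 * p) → E → E) (θ : Fin (4 * p) → E → E →L[ℝ] ℝ),
      (∀ i, ContDiffAt ℝ ∞ (θ i) y₀) ∧
      (∀ᶠ y in 𝓝 y₀,
        (∀ i, θ i y = pullForm (S.g.inner (ι ((extChartAt 𝓘(ℝ, E) x₀).symm y)))
          (chartPush F ι x₀ _) (e i y)) ∧
        ∃ J, IsAdaptedFrame S.toQuaternionHermitian ι D p ((extChartAt 𝓘(ℝ, E) x₀).symm y) J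
          fun i ↦ fromChart x₀ _ (e i y)) ∧
      extDeriv (fun y ↦ wedge fun i ↦ θ i y) y₀ = 0 := by
  obtain ⟨J, hJs, hJ, K, hK, hK', hdΩ⟩ :=
    S.exists_twoFormDeriv (ι ((extChartAt 𝓘(ℝ, E) x₀).symm y₀))
  have hs := mem_source_of_mem_target hy₀
  have hr := (extChartAt 𝓘(ℝ, E) x₀).right_inv hy₀
  have hsq := mem_chart_source F (ι ((extChartAt 𝓘(ℝ, E) x₀).symm y₀))
  have hts : ∀ᶠ y in 𝓝 y₀, (extChartAt 𝓘(ℝ, E) x₀).symm y ∈ (chartAt E x₀).source := by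
    filter_upwards [(isOpen_extChartAt_target x₀).mem_nhds hy₀] with y hy
    exact mem_source_of_mem_target hy
  have hJy := eventually_comp_extChartAt_symm hs (hM.smooth.continuous.continuousAt.eventually hJ)
  rw [hr] at hJy
  let h : E → E →L[ℝ] E →L[ℝ] ℝ := fun y ↦
    pullForm (S.g.inner (ι ((extChartAt 𝓘(ℝ, E) x₀).symm y))) (chartPush F ι x₀ _)
  let Ω : Fin 3 → E → E →L[ℝ] E →L[ℝ] ℝ := fun a y ↦
    pullForm ((S.g.inner (ι ((extChartAt 𝓘(ℝ, E) x₀).symm y))).comp (J a _)) (chartPush F ι x₀ _)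
  have hh : ContDiffAt ℝ ∞ h y₀ := contDiffAt_pullForm_chartPush hM.smooth hy₀ (b := S.g.inner) rfl
    fun u v ↦ contMDiffAt_inner S.g (contMDiffAt_fromChart hsq u) (contMDiffAt_fromChart hsq v)
  have hJc (a : Fin 3) (u v : F) := contMDiffAt_inner S.g
    (contMDiffAt_end_apply (hJs a) (contMDiffAt_fromChart hsq u)) (contMDiffAt_fromChart hsq v)
  have hΩ (a) : ContDiffAt ℝ ∞ (Ω a) y₀ := contDiffAt_pullForm_chartPush hM.smooth hy₀
    (b := fun x ↦ (S.g.inner x).comp (J a x)) rfl (hJc a)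
  have hpos : ∀ u, u ≠ 0 → 0 < h y₀ u u := fun u hu ↦ S.g.pos _ _ fun h0 ↦
    hu (chartPush_injective (F := F) hs (hM.immersion _) (h0.trans (map_zero _).symm))
  -- Taking the tangential part of `J a` on all of TM, rather than restricting `J a` to D, gives
  -- endomorphisms of a fixed space that are visibly smooth.
  choose A hAs hA using fun a ↦ exists_endomorphism_of_form hh hpos (hΩ a)
  have hA' : ∀ᶠ y in 𝓝 y₀, ∀ a u v, h y (A a y u) v = Ω a y u v := Filter.eventually_all.2 hA
  have hmem : ∀ᶠ y in 𝓝 y₀, ∀ a, J a _ ∈ S.H (ι ((extChartAt 𝓘(ℝ, E) x₀).symm y)) := by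
    filter_upwards [hJy] with y hy a
    rw [hy.2.1]
    exact Submodule.subset_span ⟨a, rfl⟩
  have hloc : ∀ᶠ y in 𝓝 y₀, QuaternionHermitianOn (h y) (fun a ↦ A a y)
      (distInChart D x₀ ((extChartAt 𝓘(ℝ, E) x₀).symm y)) ∧
      ∀ a, ∀ u ∈ distInChart D x₀ ((extChartAt 𝓘(ℝ, E) x₀).symm y),
        chartPush F ι x₀ ((extChartAt 𝓘(ℝ, E) x₀).symm y) (A a y u) =
          J a _ (chartPush F ι x₀ _ u) := by
    filter_upwards [hA', hmem, hJy, hts] with y hAy hmemy hJyy hsy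
    exact quaternionHermitianOn_chart hM hsy hJyy.1 hmemy hJyy.2.2 hAy
  obtain ⟨X, hX, hXD⟩ := hM.distribution.exists_frame_inChart hy₀
  have hmem₀ := hmem.self_of_nhds
  have hsk := S.toQuaternionHermitian.inner_skew (hmem₀ 0)
  have hd2 (t u v : E) : twoFormDeriv (fun y u v ↦ Ω 0 y u v) y₀ t u v = _ :=
    (twoFormDeriv_pullForm_chartPush hM.smooth hy₀ (b := fun x ↦ (S.g.inner x).comp (J 0 x)) rfl
      (hJc 0) (fun u v ↦ (hsk u v).trans (congrArg _ (S.g.symm _ _ _))) t u v).trans (hdΩ _ _ _)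
  simp only [fromChart_fderiv_inCharts hM.smooth hy₀ hsq] at hd2
  have hreal : ∀ z, (∀ d ∈ distInChart D x₀ ((extChartAt 𝓘(ℝ, E) x₀).symm y₀), h y₀ d z = 0) →
      S.leeForm (ι ((extChartAt 𝓘(ℝ, E) x₀).symm y₀)) (chartPush F ι x₀ _ z) = 0 ∧
      ∀ L ∈ S.H (ι ((extChartAt 𝓘(ℝ, E) x₀).symm y₀)), ∀ v : E,
        S.g.inner (ι ((extChartAt 𝓘(ℝ, E) x₀).symm y₀)) (L (chartPush F ι x₀ _ z)) (chartPush F ι x₀ _ v) = 0 ∧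
        S.g.inner (ι ((extChartAt 𝓘(ℝ, E) x₀).symm y₀)) (L (chartPush F ι x₀ _ v)) (chartPush F ι x₀ _ z) = 0 := by
    intro z hz
    have h1 := fromChart_mem_perp hs hz
    refine ⟨hB _ _ h1, fun L hL v ↦ ?_⟩
    have h2 := hM.totallyReal _ L hL _ h1 (fromChart x₀ _ v)
    refine ⟨h2, ?_⟩
    rw [S.toQuaternionHermitian.inner_skew hL, S.g.symm]
    exact neg_eq_zero.2 h2
  have hΩreal : ∀ᶠ y in 𝓝 y₀, ∀ z,
      (∀ d ∈ distInChart D x₀ ((extChartAt 𝓘(ℝ, E) x₀).symm y), h y d z = 0) →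
        ∀ v, Ω 0 y z v = 0 := by
    filter_upwards [hmem, hts] with y hmemy hsy z hz v
    exact hM.totallyReal _ _ (hmemy 0) _ (fromChart_mem_perp hsy hz) (fromChart x₀ _ v)
  have hd1 : ∀ z z' x, (∀ d ∈ distInChart D x₀ ((extChartAt 𝓘(ℝ, E) x₀).symm y₀), h y₀ d z = 0) →
      (∀ d ∈ distInChart D x₀ ((extChartAt 𝓘(ℝ, E) x₀).symm y₀), h y₀ d z' = 0) →
        twoFormDeriv (fun y u v ↦ Ω 0 y u v) y₀ z z' x = 0 := by
    intro z z' x hz hz'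
    obtain ⟨l1, r1⟩ := hreal z hz
    obtain ⟨l2, r2⟩ := hreal z' hz'
    -- Each of the six terms contains the Lee form of z or z', or a form g(L·,·), L ∈ H, with z or
    -- z' as an argument.
    rw [hd2, l1, l2, (r1 _ (hmem₀ 0) z').1, (r2 _ (hK _) x).1, (r1 _ (hK _) x).2,
      (r1 _ (hK _) z').1]
    ring
  have hd3 : ∀ z d, (∀ d ∈ distInChart D x₀ ((extChartAt 𝓘(ℝ, E) x₀).symm y₀), h y₀ d z = 0) →
      d ∈ distInChart D x₀ ((extChartAt 𝓘(ℝ, E) x₀).symm y₀) → ∀ c : ℝ,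
        twoFormDeriv (fun y u v ↦ Ω 0 y u v) y₀ z d (c • A 0 y₀ d) = 0 := by
    intro z d hz hd c
    obtain ⟨l1, r1⟩ := hreal z hz
    -- Only g(K_z d, c J₀d) survives the vanishing on z, and it is zero because K_z w is orthogonal
    -- to J₀w.
    rw [hd2, l1, (r1 _ (hmem₀ 0) _).2, (r1 _ (hmem₀ 0) _).1, (r1 _ (hK _) _).2, (r1 _ (hK _) d).1,
      map_smul, hloc.self_of_nhds.2 0 d hd]
    simp only [map_smul, hK', smul_zero, zero_mul, mul_zero, add_zero]
  obtain ⟨e, he, hframe, hclosed⟩ := exists_frame_closed (Ω := fun y u v ↦ Ω 0 y u v) hh hAs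
    (hloc.mono fun y hy ↦ hy.1) hX hXD (hA'.mono fun y hy u v ↦ (hy 0 u v).symm) hΩreal hd1 hd3
  refine ⟨e, fun i y ↦ h y (e i y), fun i ↦ hh.clm_apply (he i), ?_, hclosed⟩
  filter_upwards [hframe, hloc, hJy, hmem] with y hy hly hJyy hmemy
  refine ⟨fun i ↦ rfl, fun a ↦ J a _, hmemy, hJyy.1, hy.1, hy.2.1, fun a j ↦ ?_⟩
  have h1 := hly.2 a _ (hy.1 (finProdFinEquiv (0, j)))
  rw [← hy.2.2 a j] at h1
  exact h1

end Submanifold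

/-! ### Independence of the adapted frame. -/

section LinearAlgebra

/-- The wedge products of the dual coframes of two orthonormal frames with the same orientation
agree. -/
theorem wedge_eq_of_orthonormal {V : Type*} [AddCommGroup V] [Module ℝ V] [TopologicalSpace V]
    {n : ℕ} {e e' : Fin n → V} {θ θ' : Fin n → V →L[ℝ] ℝ}
    (hθ' : ∀ i j, θ' i (e' j) = if i = j then 1 else 0) (hsymm : ∀ i k, θ' k (e i) = θ i (e' k))
    (hexp : ∀ k v, θ' k v = ∑ i, θ' k (e i) * θ i v)
    (hdet : 0 ≤ (Matrix.of fun i k ↦ θ i (e' k)).det) : wedge θ' = wedge θ := by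
  set Q : Matrix (Fin n) (Fin n) ℝ := Matrix.of fun i k ↦ θ i (e' k) with hQ
  have h1 (v : Fin n → V) : (Matrix.of fun i j ↦ θ' i (v j)) =
      Q.transpose * Matrix.of fun i j ↦ θ i (v j) := by
    ext k j
    simp only [Matrix.of_apply, Matrix.mul_apply, Matrix.transpose_apply, hQ]
    rw [hexp]
    simp only [hsymm]
  have h2 : Q.transpose * Q = 1 := by
    rw [hQ, ← h1 e']
    ext i j
    simp [hθ', Matrix.one_apply]
  -- Orthogonality gives (det Q)² = 1, and the sign hypothesis excludes -1.
  have h3 : Q.det = 1 := by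
    have h4 := congrArg Matrix.det h2
    rw [Matrix.det_mul, Matrix.det_transpose, Matrix.det_one] at h4
    nlinarith
  ext v
  rw [wedge_apply, wedge_apply, h1, Matrix.det_mul, Matrix.det_transpose, h3, one_mul]

end LinearAlgebra

section Submanifold

variable {F : Type*} [NormedAddCommGroup F] [NormedSpace ℝ F]
variable {N : Type*} [TopologicalSpace N] [ChartedSpace F N] [IsManifold 𝓘(ℝ, F) ∞ N]
variable {E : Type*} [NormedAddCommGroup E] [NormedSpace ℝ E]
variable {M : Type*} [TopologicalSpace M] [ChartedSpace E M] [IsManifold 𝓘(ℝ, E) ∞ M]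

/-- A quaternionic basis of a fibre of `H` spans it. -/
theorem QuaternionHermitian.span_eq (S : QuaternionHermitian F N) {x : N} {J : Fin 3 → EndT F x}
    (hJ : IsQuaternionTriple J) (hH : ∀ a, J a ∈ S.H x) :
    Submodule.span ℝ (range J) = S.H x := by
  have hfin : Module.finrank ℝ (S.H x) = Fintype.card (Fin 3) := by simpa using S.finrank_H x
  have : FiniteDimensional ℝ (S.H x) := FiniteDimensional.of_finrank_pos (by rw [hfin]; simp)
  obtain ⟨v, hv⟩ : ∃ v : T F x, v ≠ 0 := by
    by_contra! h
    have h1 : S.H x = ⊥ := by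
      rw [Submodule.eq_bot_iff]
      intro K _
      ext v
      rw [h v, map_zero, map_zero]
    have h2 := S.finrank_H x
    rw [h1, finrank_bot] at h2
    exact absurd h2 (by norm_num)
  have hpos := S.g.pos x v hv
  have hself (a v) : S.g.inner x v (J a v) = 0 := by
    have h1 := S.inner_skew (hH a) v v
    rw [S.g.symm] at h1
    linarith
  have h02 (w : T F x) : J 0 (J 2 w) = -J 1 w := by rw [← hJ.mul, hJ.sq]
  have horth (a b) : S.g.inner x (J a v) (J b v) = if a = b then S.g.inner x v v else 0 := by
    have h01 : S.g.inner x (J 0 v) (J 1 v) = 0 := by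
      rw [S.inner_skew (hH 0), hJ.mul, hself, neg_zero]
    have h02 : S.g.inner x (J 0 v) (J 2 v) = 0 := by
      rw [S.inner_skew (hH 0), h02, map_neg, hself, neg_zero, neg_zero]
    have h12 : S.g.inner x (J 1 v) (J 2 v) = 0 := by
      rw [← hJ.mul, hself]
    have hd (a) : S.g.inner x (J a v) (J a v) = S.g.inner x v v := by
      rw [S.inner_skew (hH a), hJ.sq, map_neg, neg_neg]
    fin_cases a <;> fin_cases b
    · exact hd 0
    · exact h01
    · exact h02
    · exact (S.g.symm _ _ _).trans h01
    · exact hd 1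
    · exact h12
    · exact (S.g.symm _ _ _).trans h02
    · exact (S.g.symm _ _ _).trans h12
    · exact hd 2
  let ev : EndT F x →ₗ[ℝ] T F x :=
    { toFun := fun K ↦ K v, map_add' := fun _ _ ↦ rfl, map_smul' := fun _ _ ↦ rfl }
  -- At a nonzero v the vectors J_a v are orthogonal of equal length, so the forms K ↦ g(J_a v, K
  -- v)/g(v,v) are dual to the J_a; three independent elements span the rank 3 fibre.
  refine span_eq_of_dual (θ := fun a ↦ (S.g.inner x v v)⁻¹ •
    (S.g.inner x (J a v) : T F x →ₗ[ℝ] ℝ).comp ev) (fun a b ↦ ?_) hH hfin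
  have h1 : (S.g.inner x v v)⁻¹ * S.g.inner x (J a v) (J b v) = if a = b then 1 else 0 := by
    rw [horth]
    split_ifs
    · exact inv_mul_cancel₀ hpos.ne'
    · exact mul_zero _
  exact h1

variable {S : QuaternionHermitian F N} {ι : M → N} {D : ∀ x : M, Submodule ℝ (T E x)} {p : ℕ}

theorem finrank_distribution [FiniteDimensional ℝ E] {r : ℕ} (hD : IsDistribution D r) (x : M) :
    Module.finrank ℝ (D x) = r := by
  obtain ⟨U, -, hx, X, -, hX⟩ := hD x
  rw [(hX x hx).2, finrank_span_eq_card (hX x hx).1, Fintype.card_fin]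

/-- The linear forms `g(e_i, ·)` on `T_x M`. -/
def metricCoframe (S : QuaternionHermitian F N) (ι : M → N) {x : M} {k : ℕ} (e : Fin k → T E x)
    (i : Fin k) : T E x →L[ℝ] ℝ :=
  (S.g.inner (ι x) (push F ι x (e i))).comp (push F ι x)

omit [IsManifold 𝓘(ℝ, E) ∞ M] in
theorem metricCoframe_apply {x : M} {k : ℕ} (e : Fin k → T E x) (i : Fin k) (v : T E x) :
    metricCoframe S ι e i v = S.g.inner (ι x) (push F ι x (e i)) (push F ι x v) := rfl

namespace IsAdaptedFrame

variable {x : M} {J : Fin 3 → EndT F (ι x)} {e : Fin (4 * p) → T E x}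

omit [IsManifold 𝓘(ℝ, E) ∞ M] in
theorem isDualCoframe (h : IsAdaptedFrame S ι D p x J e) :
    IsDualCoframe S ι D x e (metricCoframe S ι e) :=
  ⟨fun i _ hZ ↦ hZ _ (h.mem_D i), h.orthonormal⟩

theorem expand [FiniteDimensional ℝ E] (h : IsAdaptedFrame S ι D p x J e)
    (hD : IsDistribution D (4 * p)) {d : T E x} (hd : d ∈ D x) :
    d = ∑ i, metricCoframe S ι e i d • e i := by
  have : FiniteDimensional ℝ (T E x) := inferInstanceAs (FiniteDimensional ℝ E)
  have h1 := span_eq_of_dual (θ := fun i ↦ (metricCoframe S ι e i : T E x →ₗ[ℝ] ℝ)) h.orthonormal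
    h.mem_D (by rw [finrank_distribution hD, Fintype.card_fin])
  rw [← h1, Submodule.mem_span_range_iff_exists_fun] at hd
  obtain ⟨c, rfl⟩ := hd
  refine Finset.sum_congr rfl fun i _ ↦ ?_
  congr 1
  simp only [map_sum, map_smul, h.isDualCoframe.dual, smul_eq_mul, mul_ite, mul_one, mul_zero,
    Finset.sum_ite_eq, Finset.mem_univ, if_true]

/-- The dual coframe is unique. -/
theorem eq_metricCoframe [FiniteDimensional ℝ E] (h : IsAdaptedFrame S ι D p x J e)
    (hD : IsDistribution D (4 * p)) {θ : Fin (4 * p) → T E x →L[ℝ] ℝ}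
    (hθ : IsDualCoframe S ι D x e θ) : θ = metricCoframe S ι e := by
  funext i
  ext v
  -- Any dual coframe kills this component, so its value on v is read off from the frame alone.
  have h1 : v - ∑ j, metricCoframe S ι e j v • e j ∈ perp S ι D x := by
    intro d hd
    rw [h.expand hD hd, map_sum, map_sum, sum_apply]
    refine Finset.sum_eq_zero fun j _ ↦ ?_
    rw [map_smul, map_smul, smul_apply]
    have h2 : metricCoframe S ι e j (v - ∑ j, metricCoframe S ι e j v • e j) = 0 := by
      simp [h.isDualCoframe.dual]
    rw [metricCoframe_apply] at h2
    rw [h2, smul_zero]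
  have h3 := hθ.vanish i _ h1
  simpa [hθ.dual, sub_eq_zero] using h3

/-- Two adapted frames at the same point have the same orientation. -/
theorem det_nonneg [FiniteDimensional ℝ E] (hM : IsQuaternionCRSubmanifold S ι D p)
    (h : IsAdaptedFrame S ι D p x J e) {J' : Fin 3 → EndT F (ι x)} {e' : Fin (4 * p) → T E x}
    (h' : IsAdaptedFrame S ι D p x J' e') (hp : 0 < p) :
    0 ≤ (Matrix.of fun i k ↦ metricCoframe S ι e i (e' k)).det := by
  have : FiniteDimensional ℝ (T E x) := inferInstanceAs (FiniteDimensional ℝ E)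
  have : NeZero p := ⟨hp.ne'⟩
  -- H acts on the ambient tangent space, so the comparison takes place on the image of D, which H
  -- preserves.
  let W : Submodule ℝ (T F (ι x)) := (D x).map (push (E := E) F ι x : T E x →ₗ[ℝ] T F (ι x))
  have hW {K : EndT F (ι x)} (hK : K ∈ S.H (ι x)) : ∀ w ∈ W, (K : T F (ι x) →ₗ[ℝ] T F (ι x)) w ∈ W := by
    rintro _ ⟨X, hX, rfl⟩
    obtain ⟨X', hX', h1⟩ := hM.invariant x K hK X hX
    exact ⟨X', hX', h1⟩
  let R {J : Fin 3 → EndT F (ι x)} (hJ : ∀ a, J a ∈ S.H (ι x)) (a : Fin 3) : W →ₗ[ℝ] W :=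
    (J a : T F (ι x) →ₗ[ℝ] T F (ι x)).restrict (hW (hJ a))
  have hR {J : Fin 3 → EndT F (ι x)} (hJ : ∀ a, J a ∈ S.H (ι x)) (hq : IsQuaternionTriple J) :
      QuaternionRules (R hJ) :=
    ⟨fun a w ↦ Subtype.ext (hq.sq a w), fun w ↦ Subtype.ext (hq.mul w),
      fun w ↦ Subtype.ext (hq.anticomm w)⟩
  have hfin : Fintype.card (Fin 4 × Fin p) = Module.finrank ℝ W := by
    have h1 := (Submodule.equivMapOfInjective (push (E := E) F ι x : T E x →ₗ[ℝ] T F (ι x))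
      (hM.immersion x) (D x)).finrank_eq
    rw [finrank_distribution hM.distribution] at h1
    rw [← h1]
    simp
  have : Nontrivial W := Module.nontrivial_of_finrank_pos (R := ℝ) (by rw [← hfin]; simp [hp])
  let fr (e : Fin (4 * p) → T E x) (he : ∀ i, e i ∈ D x) (i : Fin 4 × Fin p) : W :=
    ⟨push F ι x (e (finProdFinEquiv i)), e (finProdFinEquiv i), he _, rfl⟩
  have hli : LinearIndependent ℝ (fr e h.mem_D) := by
    refine linearIndependent_of_dual (θ := fun i ↦ (S.g.inner (ι x)
      (push F ι x (e (finProdFinEquiv i))) : T F (ι x) →ₗ[ℝ] ℝ).comp W.subtype) fun i j ↦ ?_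
    refine (h.orthonormal _ _).trans ?_
    simp only [EmbeddingLike.apply_eq_iff_eq]
  let b := basisOfLinearIndependentOfCardEqFinrank hli hfin
  have hb (i) : b i = fr e h.mem_D i := by simp [b]
  have hJ' (a) : J' a ∈ Submodule.span ℝ (range J) := by
    rw [S.span_eq h.triple h.mem_H]
    exact h'.mem_H a
  simp only [Submodule.mem_span_range_iff_exists_fun] at hJ'
  choose A hA using hJ'
  have key := (hR h.mem_H h.triple).basis_det_nonneg (hR h'.mem_H h'.triple) (A := Matrix.of A)
    (fun a v ↦ Subtype.ext ?_) b (fr e' h'.mem_D) (fun a j ↦ ?_) (fun a j ↦ ?_)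
  · rw [Module.Basis.det_apply] at key
    have h1 : b.toMatrix (fr e' h'.mem_D) =
        (Matrix.of fun i k ↦ metricCoframe S ι e i (e' k)).submatrix finProdFinEquiv
          finProdFinEquiv := by
      ext i j
      have h2 : (b.coord i : W →ₗ[ℝ] ℝ) = (S.g.inner (ι x)
          (push F ι x (e (finProdFinEquiv i))) : T F (ι x) →ₗ[ℝ] ℝ).comp W.subtype := by
        refine b.ext fun k ↦ ?_
        rw [Module.Basis.coord_apply, Module.Basis.repr_self, hb]
        refine Eq.trans ?_ (h.orthonormal _ _).symm
        simp only [EmbeddingLike.apply_eq_iff_eq, Finsupp.single_apply, eq_comm]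
      exact LinearMap.congr_fun h2 _
    rwa [h1, Matrix.det_submatrix_equiv_self] at key
  · have h1 := congrArg (fun L : EndT F (ι x) ↦ L v) (hA a)
    simp only [sum_apply, smul_apply] at h1
    rw [Submodule.coe_sum]
    exact h1.symm
  · rw [hb, hb]
    exact Subtype.ext (h.quaternionic a j)
  · exact Subtype.ext (h'.quaternionic a j)

theorem wedge_metricCoframe_eq [FiniteDimensional ℝ E] (hM : IsQuaternionCRSubmanifold S ι D p)
    (h : IsAdaptedFrame S ι D p x J e) {J' : Fin 3 → EndT F (ι x)} {e' : Fin (4 * p) → T E x}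
    (h' : IsAdaptedFrame S ι D p x J' e') :
    wedge (metricCoframe S ι e') = wedge (metricCoframe S ι e) := by
  -- For p = 0 both coframes are empty; the orientation argument needs a nonzero vector in D.
  obtain rfl | hp := Nat.eq_zero_or_pos p
  · congr 1
    funext i
    exact absurd i.2 (by simp)
  refine wedge_eq_of_orthonormal h'.orthonormal (fun i k ↦ S.g.symm _ _ _) (fun k v ↦ ?_)
    (h.det_nonneg hM h' hp)
  have h1 : metricCoframe S ι e' k v =
      S.g.inner (ι x) (push F ι x (∑ i, metricCoframe S ι e i (e' k) • e i)) (push F ι x v) := by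
    rw [← h.expand hM.distribution (h'.mem_D k)]
    rfl
  rw [h1]
  simp only [map_sum, map_smul, sum_apply, smul_apply, smul_eq_mul]
  refine Finset.sum_congr rfl fun i _ ↦ ?_
  rw [metricCoframe_apply e i v, metricCoframe_apply, metricCoframe_apply,
    S.g.symm _ (push F ι x (e i)) (push F ι x (e' k))]

end IsAdaptedFrame

end Submanifold

/-! ### The canonical form: existence, uniqueness, smoothness, closedness. -/

section Canonical

variable {F : Type*} [NormedAddCommGroup F] [NormedSpace ℝ F] [FiniteDimensional ℝ F]
variable {N : Type*} [TopologicalSpace N] [ChartedSpace F N] [IsManifold 𝓘(ℝ, F) ∞ N]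
variable {E : Type*} [NormedAddCommGroup E] [NormedSpace ℝ E] [FiniteDimensional ℝ E]
variable {M : Type*} [TopologicalSpace M] [ChartedSpace E M] [IsManifold 𝓘(ℝ, E) ∞ M]
variable {S : LCQK F N} {ι : M → N} {D : ∀ x : M, Submodule ℝ (T E x)} {p : ℕ}

theorem exists_isAdaptedFrame (hM : IsQuaternionCRSubmanifold S.toQuaternionHermitian ι D p)
    (hB : ∀ x : M, ∀ Z ∈ perp S.toQuaternionHermitian ι D x, S.leeForm (ι x) (push F ι x Z) = 0)
    (x : M) : ∃ J e, IsAdaptedFrame S.toQuaternionHermitian ι D p x J e := by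
  obtain ⟨e, θ, -, h, -⟩ := exists_local_frame S hM hB (mem_extChartAt_target (I := 𝓘(ℝ, E)) x)
  obtain ⟨-, J, hJ⟩ := h.self_of_nhds
  have h1 : ∃ J e, IsAdaptedFrame S.toQuaternionHermitian ι D p
      ((extChartAt 𝓘(ℝ, E) x).symm (extChartAt 𝓘(ℝ, E) x x)) J e := ⟨J, _, hJ⟩
  rwa [extChartAt_to_inv] at h1

/-- Uniqueness rests on an adapted frame existing at every point: where there is none,
`IsCanonicalForm` would impose nothing. -/
theorem existsUnique_isCanonicalForm
    (hM : IsQuaternionCRSubmanifold S.toQuaternionHermitian ι D p)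
    (hB : ∀ x : M, ∀ Z ∈ perp S.toQuaternionHermitian ι D x, S.leeForm (ι x) (push F ι x Z) = 0) :
    ∃! w : FormField E M (4 * p), IsCanonicalForm S.toQuaternionHermitian ι D p w := by
  choose J e h using exists_isAdaptedFrame hM hB
  refine ⟨fun x ↦ wedge (metricCoframe S.toQuaternionHermitian ι (e x)), fun x J' e' θ h' hθ ↦ ?_,
    fun w hw ↦ ?_⟩
  · rw [h'.eq_metricCoframe hM.distribution hθ]
    exact h'.wedge_metricCoframe_eq hM (h x)
  · funext x
    exact hw x _ _ _ (h x) (h x).isDualCoframe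

/-- `smoothForms` asks for smoothness on the whole target of each preferred chart, so the point is
arbitrary there; near it the form is the wedge product of a smooth local coframe. -/
theorem IsCanonicalForm.contDiffAt_inChart {w : FormField E M (4 * p)}
    (hw : IsCanonicalForm S.toQuaternionHermitian ι D p w)
    (hM : IsQuaternionCRSubmanifold S.toQuaternionHermitian ι D p)
    (hB : ∀ x : M, ∀ Z ∈ perp S.toQuaternionHermitian ι D x, S.leeForm (ι x) (push F ι x Z) = 0)
    {x₀ : M} {y₀ : E} (hy₀ : y₀ ∈ (extChartAt 𝓘(ℝ, E) x₀).target) :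
    ContDiffAt ℝ ∞ (inChart w x₀) y₀ ∧ extDeriv (inChart w x₀) y₀ = 0 := by
  obtain ⟨e, θ, hθ, h, hd⟩ := exists_local_frame S hM hB hy₀
  have h1 : inChart w x₀ =ᶠ[𝓝 y₀] fun y ↦ wedge fun i ↦ θ i y := by
    filter_upwards [h, (isOpen_extChartAt_target x₀).mem_nhds hy₀] with y hy hyt
    obtain ⟨hθy, J, hJ⟩ := hy
    ext v
    rw [inChart, hw _ _ _ _ hJ hJ.isDualCoframe, ← fromChart_eq_mfderiv hyt,
      ContinuousAlternatingMap.compContinuousLinearMap_apply, wedge_apply, wedge_apply]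
    congr 1
    ext i j
    simp only [Matrix.of_apply, hθy]
    rfl
  refine ⟨(ContDiffAt.wedge hθ).congr_of_eventuallyEq h1, ?_⟩
  rw [h1.extDeriv_eq, hd]

theorem IsCanonicalForm.mem_closedForms {w : FormField E M (4 * p)}
    (hw : IsCanonicalForm S.toQuaternionHermitian ι D p w)
    (hM : IsQuaternionCRSubmanifold S.toQuaternionHermitian ι D p)
    (hB : ∀ x : M, ∀ Z ∈ perp S.toQuaternionHermitian ι D x, S.leeForm (ι x) (push F ι x Z) = 0) :
    w ∈ smoothForms E M (4 * p) ∧ extD w = 0 := by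
  refine ⟨fun x₀ y hy ↦ (hw.contDiffAt_inChart hM hB hy).1.contDiffWithinAt, ?_⟩
  funext x
  rw [extD, (hw.contDiffAt_inChart hM hB (mem_extChartAt_target x)).2]
  rfl

end Canonical

end QuaternionCR

end

theorem theorem5p1
    {F : Type*} [NormedAddCommGroup F] [NormedSpace ℝ F] [FiniteDimensional ℝ F]
    {N : Type*} [TopologicalSpace N] [T2Space N] [SecondCountableTopology N]
    [ChartedSpace F N] [IsManifold 𝓘(ℝ, F) ∞ N]
    (S : LCQK F N)
    {E : Type*} [NormedAddCommGroup E] [NormedSpace ℝ E] [FiniteDimensional ℝ E]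
    {M : Type*} [TopologicalSpace M] [T2Space M] [SecondCountableTopology M] [CompactSpace M]
    [ChartedSpace E M] [IsManifold 𝓘(ℝ, E) ∞ M]
    (ι : M → N) (D : ∀ x : M, Submodule ℝ (TangentSpace 𝓘(ℝ, E) x)) (p : ℕ)
    (hM : IsQuaternionCRSubmanifold S.toQuaternionHermitian ι D p)
    (hB : ∀ x : M, ∀ Z ∈ perp S.toQuaternionHermitian ι D x,
      S.g.inner (ι x) (push F ι x Z) (S.leeField (ι x)) = 0) :
    (∃! w : FormField E M (4 * p), IsCanonicalForm S.toQuaternionHermitian ι D p w) ∧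
    (∀ w : FormField E M (4 * p), IsCanonicalForm S.toQuaternionHermitian ι D p w →
      w ∈ smoothForms E M (4 * p) ∧ extD w = 0) ∧
    (∃! c : DeRham E M (4 * p), ∃ w : closedForms E M (4 * p),
      IsCanonicalForm S.toQuaternionHermitian ι D p w.1 ∧ deRhamClass w = c) := by
  have hB' : ∀ x : M, ∀ Z ∈ perp S.toQuaternionHermitian ι D x,
      S.leeForm (ι x) (push F ι x Z) = 0 := fun x Z hZ ↦ by
    rw [← S.leeField_spec]
    exact hB x Z hZ
  obtain ⟨w, hw, huniq⟩ := existsUnique_isCanonicalForm hM hB'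
  refine ⟨⟨w, hw, huniq⟩, fun w hw ↦ hw.mem_closedForms hM hB', ?_⟩
  refine ⟨deRhamClass ⟨w, mem_closedForms.2 (hw.mem_closedForms hM hB')⟩, ⟨_, hw, rfl⟩, ?_⟩
  rintro _ ⟨w', hw', rfl⟩
  congr 1
  exact Subtype.ext (huniq _ hw')
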